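/- **Setting.** An uncapacitated single-market production-distribution game has players $N=\{1,\dots,n\}$, $n\ge 1$, a market price $r$, unit costs $c_1\le c_2\le\dots\le c_n\le r$ (so the unit profits $\alpha_i=r-c_i$ satisfy $\alpha_1\ge\dots\ge\alpha_n\ge 0$) and demand shares $\lambda_i\ge 0$ with $\sum_i\lambda_i=1$. The value $v(S)$ of a coalition $S\subseteq N$ is the maximum of $\sum_{i\in S}(r-c_i)y_i$ over $y\ge 0$ with $\sum_{i\in S}y_i\le\sum_{i\in S}\lambda_i$. Write $x(S)=\sum_{i\in S}x_i$. The (pre)nucleolus is the set of $x\in\mathbb R^n$ with $x(N)=v(N)$ such that no $y\in\mathbb R^n$ with $y(N)=v(N)$ has a non-decreasingly sorted vector of excesses $(y(S)-v(S))_{\emptyset\ne S\subsetneq N}$ that is lexicographically larger than that of $x$. For $F\subseteq N\setminus\{1\}$ let $\mathcal F(F)=\{S: S\subseteq F\text{ or }N\setminus F\subseteq S\}$. Given $F$ and $x^\circ\in\mathbb R^n$, let $(D)$ be the Maschler program: maximise $\varepsilon$ over $(x,\varepsilon)$ subject to $x(S)\ge v(S)+\varepsilon$ for $S\notin\mathcal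 F(F)$ and $x(S)=x^\circ(S)$ for $S\in\mathcal F(F)$. It is the dual of the program $(P)$: minimise $-\sum_{S\in\mathcal F(F)}x^\circ(S)y_S-\sum_{S\notin\mathcal F(F)}v(S)y_S$ subject to $\sum_{S\ni i}y_S=0$ for all $i\in N$, $\sum_{S\notin\mathcal F(F)}y_S=1$, and $y_S\ge0$ for $S\notin\mathcal F(F)$. At a point $(x,\varepsilon)$ the restricted primal $(RP)$ is: minimise $\delta\ge0$ subject to $\sum_{S\ni i}y_S=0$ for all $i$, $\sum_{S\notin\mathcal F(F)}y_S+\delta=1$, $y_S\ge0$ for $S\notin\mathcal F(F)$, and $y_S=0$ if $S\notin\mathcal F(F)$ and $x(S)>v(S)+\varepsilon$. Its dual $(DRP)$ is: maximise $\tilde\varepsilon\le1$ subject to $\tilde x(S)\ge\tilde\varepsilon$ for those $S\notin\mathcal F(F)$ with $x(S)=v(S)+\varepsilon$, and $\tilde x(S)=0$ for $S\in\mathcal F(F)$. **Algorithm.** A state is a triple $(F,x,\varepsilon)$; start with $F=\emptyset$, $x_i=\lambda_i\alpha_1$, $\varepsilon=0$, and stop when $F=N\setminus\{1\}$. The current Maschler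 program of a state is $(D)$ with $x^\circ=x$, and its candidates are the sets $S\notin\mathcal F(F)$ with $1\notin S$. In a round, with $\tilde x_1=n-1-|F|$, $\tilde x_i=-1$ for $i\notin F$, $i\neq1$, and $\tilde x_i=0$ for $i\in F$, choose a candidate $\bar S$ attaining $$\lambda=\min_{S\notin\mathcal F(F),\,1\notin S}\frac{x(S)-v(S)-\varepsilon}{1+|S\setminus F|},$$ and replace $(F,x,\varepsilon)$ by $(F\cup\bar S,\;x+\lambda\tilde x,\;\varepsilon+\lambda)$. **Statement.** Call the following the invariant: $1\notin F$, $(x,\varepsilon)$ is feasible for the current Maschler program, and $x(N\setminus i)=v(N\setminus i)+\varepsilon$ for all $i\notin F$, $i\ne1$. 1. The starting state satisfies the invariant. 2. Let $(F,x,\varepsilon)$ satisfy the invariant with $F\ne N\setminus\{1\}$. - If some candidate $S$ has $x(S)=v(S)+\varepsilon$, then $(RP)$ has value $0$ and $(x,\varepsilon)$ is optimal for the current Maschler program. If no candidate does, then $(RP)$ has value $1$ and $(\tilde x,1)$ is optimal for $(DRP)$. - A round can be performed. In every round, $\lambda$ is the largest number $\ge0$ such that $(x+\lambda\tilde x,\varepsilon+\lambda)$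 is feasible for the current Maschler program, and $\lambda>0$ if and only if $(RP)$ has value $1$. At the new point, $(RP)$ (for the old $F$) has value $0$ and the new point is optimal for the current Maschler program: each Maschler program is solved in at most one primal-dual step. Moreover $(P)$ has an optimal solution $y$, whose objective value is the new $\varepsilon$, with $y_{\bar S}>0$ and $y_{N\setminus i}>0$ for all $i\in\bar S\setminus F$. - $F$ grows strictly and the invariant is preserved. 3. Every execution from the starting state has at most $n-1$ rounds, and all its states satisfy the invariant. If it has stopped, its rounds form a complete revised Maschler scheme: the fixed families begin with $\{\emptyset,N\}$ and fixed value $v(N)$ for $N$; each round yields an optimal solution of its Maschler program; the next family is strictly larger, consists of sets $S$ for which $x(S)$ is constant on the set of optimal solutions, with this constant as fixed value, and old fixed values are kept; after the last round exactly one point satisfies the fixed equations. The nucleolus is exactly the set consisting of the final $x$. 4. There are a single real-RAM program (unit-cost arithmetic and comparison on real numbers, unit-cost addition, subtraction and comparison of natural numbers, unit-cost array access) and a constant $C$ such that, for all $n\ge1$ and every such game, on input $n,r,c,\lambda$ the program halts after at most $C\,n^4$ steps, having output the nucleolus together with a log of the successive states $(F,x,\varepsilon)$ of a complete execution of the algorithm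 above, whose final $x$ is the output. -/

import Mathlib

noncomputable section

/-! ### Cooperative games, excess vectors and the nucleolus -/

namespace Coop

variable {n : ℕ}

/-- The total `x(S)` that the payoff vector `x` gives to the coalition `S`. -/
def pay (x : Fin n → ℝ) (S : Finset (Fin n)) : ℝ := ∑ i ∈ S, x i

/-- The coalitions other than `∅` and the grand coalition. -/
def proper (n : ℕ) : Finset (Finset (Fin n)) :=
  Finset.univ.filter fun S => S ≠ ∅ ∧ S ≠ Finset.univ

/-- The excesses `x(S) - v(S)` of all proper coalitions, listed in non-decreasing order. -/
def sortedExcess (v : Finset (Fin n) → ℝ) (x : Fin n → ℝ) : List ℝ :=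
  ((proper n).val.map fun S => pay x S - v S).sort (· ≤ ·)

/-- The excess vector of `y` is leximin superior to the excess vector of `x`. -/
def LeximinSuperior (v : Finset (Fin n) → ℝ) (y x : Fin n → ℝ) : Prop :=
  List.Lex (· < ·) (sortedExcess v x) (sortedExcess v y)

/-- The (pre)nucleolus, as the set of efficient payoff vectors to which no efficient payoff
vector is leximin superior. -/
def nucleolus (v : Finset (Fin n) → ℝ) : Set (Fin n → ℝ) :=
  {x | pay x Finset.univ = v Finset.univ ∧
    ¬ ∃ y : Fin n → ℝ, pay y Finset.univ = v Finset.univ ∧ LeximinSuperior v y x}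

/-! ### The linear programs of the revised Maschler scheme -/

/-- Feasibility in the Maschler program with fixed family `Fam` and fixed values `c`:
maximise `ε` subject to `x(S) ≥ v(S) + ε` for `S ∉ Fam` and `x(S) = c(S)` for `S ∈ Fam`. -/
def DFeasible (v : Finset (Fin n) → ℝ) (Fam : Finset (Finset (Fin n)))
    (c : Finset (Fin n) → ℝ) (x : Fin n → ℝ) (ε : ℝ) : Prop :=
  (∀ S, S ∉ Fam → v S + ε ≤ pay x S) ∧ ∀ S ∈ Fam, pay x S = c S

/-- `(x, ε)` is an optimal solution of the Maschler program. -/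
def DOptimal (v : Finset (Fin n) → ℝ) (Fam : Finset (Finset (Fin n)))
    (c : Finset (Fin n) → ℝ) (x : Fin n → ℝ) (ε : ℝ) : Prop :=
  DFeasible v Fam c x ε ∧ ∀ x' ε', DFeasible v Fam c x' ε' → ε' ≤ ε

/-- Feasibility in the linear program whose dual is the Maschler program; the variables are
indexed by all coalitions and the matrix has their characteristic vectors as columns. -/
def PFeasible (Fam : Finset (Finset (Fin n))) (y : Finset (Fin n) → ℝ) : Prop :=
  (∀ i : Fin n, ∑ S with i ∈ S, y S = 0) ∧ (∑ S with S ∉ Fam, y S = 1) ∧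
    ∀ S, S ∉ Fam → 0 ≤ y S

/-- The objective (to be minimised) of that program. -/
def PObjective (v : Finset (Fin n) → ℝ) (Fam : Finset (Finset (Fin n)))
    (c : Finset (Fin n) → ℝ) (y : Finset (Fin n) → ℝ) : ℝ :=
  - (∑ S with S ∈ Fam, c S * y S) - ∑ S with S ∉ Fam, v S * y S

/-- `y` is an optimal solution of that program. -/
def POptimal (v : Finset (Fin n) → ℝ) (Fam : Finset (Finset (Fin n)))
    (c : Finset (Fin n) → ℝ) (y : Finset (Fin n) → ℝ) : Prop :=
  PFeasible Fam y ∧ ∀ y', PFeasible Fam y' → PObjective v Fam c y ≤ PObjective v Fam c y'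

/-- Feasibility in the restricted primal at `(x, ε)`. -/
def RPFeasible (v : Finset (Fin n) → ℝ) (Fam : Finset (Finset (Fin n)))
    (x : Fin n → ℝ) (ε : ℝ) (y : Finset (Fin n) → ℝ) (δ : ℝ) : Prop :=
  (∀ i : Fin n, ∑ S with i ∈ S, y S = 0) ∧ ((∑ S with S ∉ Fam, y S) + δ = 1) ∧
    (∀ S, S ∉ Fam → 0 ≤ y S) ∧ (∀ S, S ∉ Fam → v S + ε < pay x S → y S = 0) ∧ 0 ≤ δ

/-- The restricted primal (minimise `δ`) at `(x, ε)` has optimal value `b`. -/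
def RPValue (v : Finset (Fin n) → ℝ) (Fam : Finset (Finset (Fin n)))
    (x : Fin n → ℝ) (ε : ℝ) (b : ℝ) : Prop :=
  IsLeast {δ | ∃ y, RPFeasible v Fam x ε y δ} b

/-- Feasibility in the dual of the restricted primal at `(x, ε)`. -/
def DRPFeasible (v : Finset (Fin n) → ℝ) (Fam : Finset (Finset (Fin n)))
    (x : Fin n → ℝ) (ε : ℝ) (dx : Fin n → ℝ) (dε : ℝ) : Prop :=
  (∀ S, S ∉ Fam → pay x S = v S + ε → dε ≤ pay dx S) ∧ (∀ S ∈ Fam, pay dx S = 0) ∧ dε ≤ 1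

/-- `(dx, dε)` is an optimal solution of the dual of the restricted primal (maximise `dε`). -/
def DRPOptimal (v : Finset (Fin n) → ℝ) (Fam : Finset (Finset (Fin n)))
    (x : Fin n → ℝ) (ε : ℝ) (dx : Fin n → ℝ) (dε : ℝ) : Prop :=
  DRPFeasible v Fam x ε dx dε ∧ ∀ dx' dε', DRPFeasible v Fam x ε dx' dε' → dε' ≤ dε

/-- A completed revised Maschler scheme with `K` rounds for the game `v`. Round `k < K` solves
the Maschler program with fixed family `Fam k` and fixed values `c k`, with optimal solution
`(x k, ε k)`. The next family is strictly larger and consists of coalitions whose payoff is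
constant on the set of optimal solutions. After the last round one point remains. -/
structure IsRevisedMaschler (v : Finset (Fin n) → ℝ) (K : ℕ)
    (Fam : ℕ → Finset (Finset (Fin n))) (c : ℕ → Finset (Fin n) → ℝ)
    (x : ℕ → Fin n → ℝ) (ε : ℕ → ℝ) : Prop where
  fam_zero : Fam 0 = {∅, Finset.univ}
  val_univ : c 0 Finset.univ = v Finset.univ
  val_empty : c 0 ∅ = 0
  optimal : ∀ k < K, DOptimal v (Fam k) (c k) (x k) (ε k)
  grows : ∀ k < K, Fam k ⊂ Fam (k + 1)
  extends_val : ∀ k < K, ∀ S ∈ Fam k, c (k + 1) S = c k S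
  fixed : ∀ k < K, ∀ S ∈ Fam (k + 1), ∀ z,
    DOptimal v (Fam k) (c k) z (ε k) → pay z S = c (k + 1) S
  single : ∃! z : Fin n → ℝ, ∀ S ∈ Fam K, pay z S = c K S

end Coop

/-! ### Production-distribution games -/

/-- A production-distribution game with players `N` and markets `M`: prices `r`, unit costs `c`,
owned demands `d`, and capacities `q` (possibly `⊤`, no bound). -/
structure ProdDistGame (N M : Type) [Fintype N] [Fintype M] where
  r : M → ℝ
  c : N → M → ℝ
  d : N → M → ℝ
  q : N → EReal
  d_nonneg : ∀ i j, 0 ≤ d i j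
  serves : ∀ i, ((∑ j, d i j : ℝ) : EReal) ≤ q i

namespace ProdDistGame

variable {N M : Type} [Fintype N] [Fintype M]

/-- `y` is a feasible production plan of the coalition `S`. -/
def Plan (G : ProdDistGame N M) (S : Finset N) (y : N → M → ℝ) : Prop :=
  (∀ j, ∑ i ∈ S, y i j ≤ ∑ i ∈ S, G.d i j) ∧
    (∀ i ∈ S, ((∑ j, y i j : ℝ) : EReal) ≤ G.q i) ∧ ∀ i ∈ S, ∀ j, 0 ≤ y i j

/-- The value of a coalition: the maximum profit of a feasible plan. -/
def value (G : ProdDistGame N M) (S : Finset N) : ℝ :=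
  sSup {p | ∃ y, G.Plan S y ∧ p = ∑ i ∈ S, ∑ j, (G.r j - G.c i j) * y i j}

end ProdDistGame

/-- The data of an uncapacitated single-market game on `n` players: market price `r`, unit costs
`c` (the unit profits `r - c i` are non-increasing and non-negative), and demand shares. -/
structure SingleMarket (n : ℕ) where
  r : ℝ
  c : Fin n → ℝ
  share : Fin n → ℝ
  c_mono : Monotone c
  c_le : ∀ i, c i ≤ r
  share_nonneg : ∀ i, 0 ≤ share i
  share_sum : ∑ i, share i = 1

/-- The three data that the primal-dual algorithm carries from round to round. -/
@[ext] structure PDState (n : ℕ) where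
  F : Finset (Fin n)
  x : Fin n → ℝ
  ε : ℝ

namespace SingleMarket

open Coop

variable {n : ℕ}

/-- The associated production-distribution game: one market, no capacity bounds. -/
def toGame (G : SingleMarket n) : ProdDistGame (Fin n) Unit where
  r := fun _ => G.r
  c := fun i _ => G.c i
  d := fun i _ => G.share i
  q := fun _ => ⊤
  d_nonneg := fun i _ => G.share_nonneg i
  serves := fun _ => le_top

/-- The characteristic function of the game. -/
def v (G : SingleMarket n) (S : Finset (Fin n)) : ℝ := G.toGame.value S

/-! ### The primal-dual algorithm (the most profitable player `1` is `0 : Fin n`) -/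

/-- All subsets of `F` and all complements of subsets of `F`. -/
def fam (F : Finset (Fin n)) : Finset (Finset (Fin n)) :=
  Finset.univ.filter fun S => S ⊆ F ∨ Fᶜ ⊆ S

/-- The starting state: `F = ∅`, every player receives her share at the best unit profit,
and `ε = 0`. -/
def start [NeZero n] (G : SingleMarket n) : PDState n where
  F := ∅
  x := fun i => G.share i * (G.r - G.c 0)
  ε := 0

/-- The `x`-part of the dual direction; its `ε`-part is `1`. -/
def dir [NeZero n] (F : Finset (Fin n)) (i : Fin n) : ℝ :=
  if i = 0 then (n : ℝ) - 1 - F.card else if i ∈ F then 0 else -1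

/-- The algorithm stops when `F` contains all players but the first. -/
def Terminal [NeZero n] (s : PDState n) : Prop := s.F = {0}ᶜ

/-- The coalitions outside the family of `F` that do not contain the first player. -/
def candidates [NeZero n] (F : Finset (Fin n)) : Finset (Finset (Fin n)) :=
  Finset.univ.filter fun S => S ∉ fam F ∧ (0 : Fin n) ∉ S

/-- The bound that a candidate coalition puts on the step length. -/
def ratio (G : SingleMarket n) (s : PDState n) (S : Finset (Fin n)) : ℝ :=
  (pay s.x S - G.v S - s.ε) / (1 + ((S \ s.F).card : ℝ))

/-- One round: choose a candidate `S` of minimum ratio, move `(x, ε)` along the dual direction by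
that ratio, and add `S` to `F`. -/
structure Round [NeZero n] (G : SingleMarket n) (s : PDState n) (S : Finset (Fin n))
    (s' : PDState n) : Prop where
  not_terminal : ¬ Terminal s
  mem : S ∈ candidates s.F
  minimal : ∀ T ∈ candidates s.F, G.ratio s S ≤ G.ratio s T
  x_eq : s'.x = fun i => s.x i + G.ratio s S * dir s.F i
  ε_eq : s'.ε = s.ε + G.ratio s S
  F_eq : s'.F = S ∪ s.F

/-- The first `K` rounds of an execution of the algorithm, with successive states `σ`. -/
def IsRun [NeZero n] (G : SingleMarket n) (K : ℕ) (σ : ℕ → PDState n) : Prop :=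
  σ 0 = G.start ∧ ∀ k < K, ∃ S, G.Round (σ k) S (σ (k + 1))

/-- The invariant of the algorithm: `1 ∉ F`, the pair `(x, ε)` is feasible for the current
Maschler program (whose fixed values are the current ones), and `x(N ∖ i) = v(N ∖ i) + ε` for
every `i ∉ F` other than the first player. -/
structure Inv [NeZero n] (G : SingleMarket n) (s : PDState n) : Prop where
  first : (0 : Fin n) ∉ s.F
  feasible : DFeasible G.v (fam s.F) (pay s.x) s.x s.ε
  tight : ∀ i, i ∉ s.F → i ≠ 0 → pay s.x {i}ᶜ = G.v {i}ᶜ + s.ε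

end SingleMarket

/-! ### A real RAM

Programs of a small imperative language over finitely many (named) arrays of natural numbers and
of real numbers. Natural numbers can be added, subtracted and compared; real numbers can be added,
subtracted, multiplied, divided and compared, and the only constants are rational. Every memory
access, arithmetic operation, comparison, assignment and test costs one step. -/

namespace RealRAM

/-- The memory: array `a` has the cells `nat a i`, respectively `real a i`. -/
structure Mem where
  nat : ℕ → ℕ → ℕ
  real : ℕ → ℕ → ℝ

def Mem.setNat (m : Mem) (a i k : ℕ) : Mem :=
  { m with nat := Function.update m.nat a (Function.update (m.nat a) i k) }

def Mem.setReal (m : Mem) (a i : ℕ) (z : ℝ) : Mem :=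
  { m with real := Function.update m.real a (Function.update (m.real a) i z) }

inductive NExpr where
  | const (k : ℕ)
  | get (a : ℕ) (i : NExpr)
  | add (e f : NExpr)
  | sub (e f : NExpr)

def NExpr.eval (m : Mem) : NExpr → ℕ
  | .const k => k
  | .get a i => m.nat a (i.eval m)
  | .add e f => e.eval m + f.eval m
  | .sub e f => e.eval m - f.eval m

def NExpr.cost : NExpr → ℕ
  | .const _ => 1
  | .get _ i => i.cost + 1
  | .add e f => e.cost + f.cost + 1
  | .sub e f => e.cost + f.cost + 1

inductive RExpr where
  | const (q : ℚ)
  | get (a : ℕ) (i : NExpr)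
  | add (e f : RExpr)
  | sub (e f : RExpr)
  | mul (e f : RExpr)
  | div (e f : RExpr)

def RExpr.eval (m : Mem) : RExpr → ℝ
  | .const q => (q : ℝ)
  | .get a i => m.real a (i.eval m)
  | .add e f => e.eval m + f.eval m
  | .sub e f => e.eval m - f.eval m
  | .mul e f => e.eval m * f.eval m
  | .div e f => e.eval m / f.eval m

def RExpr.cost : RExpr → ℕ
  | .const _ => 1
  | .get _ i => i.cost + 1
  | .add e f => e.cost + f.cost + 1
  | .sub e f => e.cost + f.cost + 1
  | .mul e f => e.cost + f.cost + 1
  | .div e f => e.cost + f.cost + 1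

inductive BExpr where
  | natLt (e f : NExpr)
  | natEq (e f : NExpr)
  | realLt (e f : RExpr)
  | neg (b : BExpr)
  | conj (b b' : BExpr)

def BExpr.eval (m : Mem) : BExpr → Prop
  | .natLt e f => e.eval m < f.eval m
  | .natEq e f => e.eval m = f.eval m
  | .realLt e f => e.eval m < f.eval m
  | .neg b => ¬ b.eval m
  | .conj b b' => b.eval m ∧ b'.eval m

def BExpr.cost : BExpr → ℕ
  | .natLt e f => e.cost + f.cost + 1
  | .natEq e f => e.cost + f.cost + 1
  | .realLt e f => e.cost + f.cost + 1
  | .neg b => b.cost + 1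
  | .conj b b' => b.cost + b'.cost + 1

inductive Prog where
  | skip
  | setNat (a : ℕ) (i : NExpr) (e : NExpr)
  | setReal (a : ℕ) (i : NExpr) (e : RExpr)
  | seq (p p' : Prog)
  | cond (b : BExpr) (p p' : Prog)
  | loop (b : BExpr) (p : Prog)

/-- `Exec p m m' t`: started in memory `m`, the program `p` halts in memory `m'` after exactly `t`
steps; `loop b p` repeats `p` while `b` holds. -/
inductive Exec : Prog → Mem → Mem → ℕ → Prop where
  | skip (m : Mem) : Exec .skip m m 1
  | setNat (a : ℕ) (i e : NExpr) (m : Mem) :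
      Exec (.setNat a i e) m (m.setNat a (i.eval m) (e.eval m)) (i.cost + e.cost + 1)
  | setReal (a : ℕ) (i : NExpr) (e : RExpr) (m : Mem) :
      Exec (.setReal a i e) m (m.setReal a (i.eval m) (e.eval m)) (i.cost + e.cost + 1)
  | seq {p p' : Prog} {m m' m'' : Mem} {t t' : ℕ} :
      Exec p m m' t → Exec p' m' m'' t' → Exec (.seq p p') m m'' (t + t')
  | condTrue {b : BExpr} {p p' : Prog} {m m' : Mem} {t : ℕ} :
      b.eval m → Exec p m m' t → Exec (.cond b p p') m m' (b.cost + 1 + t)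
  | condFalse {b : BExpr} {p p' : Prog} {m m' : Mem} {t : ℕ} :
      ¬ b.eval m → Exec p' m m' t → Exec (.cond b p p') m m' (b.cost + 1 + t)
  | loopDone {b : BExpr} {p : Prog} {m : Mem} :
      ¬ b.eval m → Exec (.loop b p) m m (b.cost + 1)
  | loopStep {b : BExpr} {p : Prog} {m m' m'' : Mem} {t t' : ℕ} :
      b.eval m → Exec p m m' t → Exec (.loop b p) m' m'' t' →
      Exec (.loop b p) m m'' (b.cost + 1 + t + t')

end RealRAM

namespace SingleMarket

variable {n : ℕ}

/-- The input: `n` in array `0` of natural numbers; price, costs and shares in the arrays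
`0`, `1`, `2` of real numbers; all other cells are `0`. -/
def input (G : SingleMarket n) : RealRAM.Mem where
  nat := fun a i => if a = 0 ∧ i = 0 then n else 0
  real := fun a i =>
    if a = 0 ∧ i = 0 then G.r
    else if h : i < n then
      if a = 1 then G.c ⟨i, h⟩ else if a = 2 then G.share ⟨i, h⟩ else 0
    else 0

/-- The number of rounds that the final memory reports. -/
def outRounds (m : RealRAM.Mem) : ℕ := m.nat 1 0

/-- The payoff vector that the final memory reports. -/
def outPayoff (n : ℕ) (m : RealRAM.Mem) : Fin n → ℝ := fun i => m.real 3 i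

/-- The log of the states after `k = 0, 1, 2, …` rounds in the final memory: row `k` of the
array `2` of natural numbers marks the members of `F`, row `k` of the array `4` of real numbers
holds `x`, and cell `k` of the array `5` holds `ε`. -/
def outLog (n : ℕ) (m : RealRAM.Mem) (k : ℕ) : PDState n where
  F := Finset.univ.filter fun i : Fin n => m.nat 2 (k * n + i) = 1
  x := fun i => m.real 4 (k * n + i)
  ε := m.real 5 k

end SingleMarket

end

/-! Costs are sorted and capacities unbounded, so the least member of `S` produces everything and `v
S` is its unit profit times the demand share of `S` (`v_eq_of_min`). Coalitions containing player
`0` therefore have additive values, and only coalitions without `0` can obstruct a step.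

The dual direction takes one unit from every player outside `F` other than `0` and gives the
proceeds to `0`. It leaves fixed coalitions alone, raises `x(N ∖ i)` exactly as fast as `ε` for each
such player `i`, and raises every unfixed coalition with `0` at least as fast. The slack of a
candidate `S` falls at rate `1 + |S ∖ F|`, so the minimum ratio is the first blocking time. When `S`
blocks, the identity `e_S + ∑_{i ∈ S∖F} e_{N∖i} = ∑_{i ∈ S∩F} e_i + |S∖F| e_N` between
characteristic vectors, divided by `1 + |S∖F|`, is a solution of the program dual to the Maschler
program (`certificate`). It lives on tight constraints, hence is optimal (`optimal_of_tight`).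
Complementary slackness makes `N ∖ i` tight at all optimal solutions for `i ∈ S∖F`, so `x_i` is
determined there (`Round.pay_eq_of_optimal`) and `F` may absorb `S`.

An efficient `y` other than the final point departs from it in some first round. There `y` has an
unfixed excess below the `ε` of that round, the final point has none, and the fixed excesses agree
(`IsRun.leximinSuperior`).

For the running time, `v S` is the maximum over `j ∈ S` of the unit profit of `j` times the share of
`S`. With `j` guessed, the ratio is a linear fraction; against a target ratio `ρ` it is best to take
the members of `F` of negative weight and the outsiders of weight at most `ρ`. These threshold sets
are indexed by one outsider `p`, with a bit `b` for the degenerate case (`exists_trialRatio_le`).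
Rounds, `j`, `p` and the scan of a trial give four nested loops (`Prog.work_le`). -/

namespace Coop

variable {n : ℕ}

/-! ### Payoffs and linear programming duality. -/

theorem pay_add_mul (x d : Fin n → ℝ) (l : ℝ) (S : Finset (Fin n)) :
    pay (fun i => x i + l * d i) S = pay x S + l * pay d S := by
  simp [pay, Finset.sum_add_distrib, Finset.mul_sum]

theorem pay_compl (x : Fin n → ℝ) (S : Finset (Fin n)) :
    pay x Sᶜ = pay x Finset.univ - pay x S := by
  rw [eq_sub_iff_add_eq, pay, pay, pay, add_comm, Finset.sum_add_sum_compl]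

theorem pay_single (i : Fin n) (S : Finset (Fin n)) :
    pay (Pi.single i (1 : ℝ)) S = if i ∈ S then 1 else 0 := by
  simp [pay, Pi.single_apply]

/-- The columns of the program combine to zero, so every payoff vector is balanced against it. -/
theorem sum_mul_pay_eq_zero {y : Finset (Fin n) → ℝ}
    (hy : ∀ i : Fin n, ∑ S with i ∈ S, y S = 0) (x : Fin n → ℝ) : ∑ T, y T * pay x T = 0 := by
  have h : ∀ T : Finset (Fin n), y T * pay x T = ∑ i, if i ∈ T then y T * x i else 0 := by
    intro T
    rw [pay, Finset.mul_sum, ← Finset.sum_filter]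
    simp
  simp_rw [h]
  rw [Finset.sum_comm]
  refine Finset.sum_eq_zero fun i _ => ?_
  rw [← Finset.sum_filter, ← Finset.sum_mul, hy i, zero_mul]

/-- The duality gap is the weighted sum of the slacks. -/
theorem PFeasible.gap {v : Finset (Fin n) → ℝ} {Fam : Finset (Finset (Fin n))}
    {c y : Finset (Fin n) → ℝ} (hy : PFeasible Fam y) {z : Fin n → ℝ}
    (hz : ∀ S ∈ Fam, pay z S = c S) (e : ℝ) :
    PObjective v Fam c y - e = ∑ T with T ∉ Fam, y T * (pay z T - v T - e) := by
  have h0 := sum_mul_pay_eq_zero hy.1 z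
  rw [← Finset.sum_filter_add_sum_filter_not Finset.univ (fun T => T ∈ Fam)] at h0
  have h1 : ∑ T with T ∈ Fam, y T * pay z T = ∑ T with T ∈ Fam, c T * y T :=
    Finset.sum_congr rfl fun T hT => by rw [hz T (Finset.mem_filter.1 hT).2, mul_comm]
  have h2 : ∑ T with T ∉ Fam, y T * (pay z T - v T - e) =
      ∑ T with T ∉ Fam, y T * pay z T - ∑ T with T ∉ Fam, v T * y T
        - e * ∑ T with T ∉ Fam, y T := by
    rw [Finset.mul_sum, ← Finset.sum_sub_distrib, ← Finset.sum_sub_distrib]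
    exact Finset.sum_congr rfl fun T _ => by ring
  rw [h2, hy.2.1, PObjective]
  linarith

theorem PFeasible.le_objective {v : Finset (Fin n) → ℝ} {Fam : Finset (Finset (Fin n))}
    {c y : Finset (Fin n) → ℝ} (hy : PFeasible Fam y) {z : Fin n → ℝ} {e : ℝ}
    (hz : DFeasible v Fam c z e) : e ≤ PObjective v Fam c y := by
  have h := hy.gap (v := v) hz.2 e
  have : 0 ≤ ∑ T with T ∉ Fam, y T * (pay z T - v T - e) :=
    Finset.sum_nonneg fun T hT => by
      have hT := (Finset.mem_filter.1 hT).2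
      exact mul_nonneg (hy.2.2 T hT) (by linarith [hz.1 T hT])
  linarith

/-- Complementary slackness. -/
theorem PFeasible.tight_of_pos {v : Finset (Fin n) → ℝ} {Fam : Finset (Finset (Fin n))}
    {c y : Finset (Fin n) → ℝ} (hy : PFeasible Fam y) {z : Fin n → ℝ}
    (hz : DFeasible v Fam c z (PObjective v Fam c y)) {T : Finset (Fin n)} (hT : T ∉ Fam)
    (hpos : 0 < y T) : pay z T = v T + PObjective v Fam c y := by
  have h := hy.gap (v := v) hz.2 (PObjective v Fam c y)
  rw [sub_self, eq_comm, Finset.sum_eq_zero_iff_of_nonneg] at h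
  · have := h T (by simpa using hT)
    rcases mul_eq_zero.1 this with h | h <;> linarith
  · intro T hT
    have hT := (Finset.mem_filter.1 hT).2
    exact mul_nonneg (hy.2.2 T hT) (by linarith [hz.1 T hT])

theorem optimal_of_objective_eq {v : Finset (Fin n) → ℝ} {Fam : Finset (Finset (Fin n))}
    {c y : Finset (Fin n) → ℝ} (hy : PFeasible Fam y) {z : Fin n → ℝ} {e : ℝ}
    (hz : DFeasible v Fam c z e) (h : PObjective v Fam c y = e) :
    DOptimal v Fam c z e ∧ POptimal v Fam c y :=
  ⟨⟨hz, fun _ _ h' => h ▸ hy.le_objective h'⟩, hy, fun _ h' => h ▸ h'.le_objective hz⟩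

/-- A direction with value `1` bounds the restricted primal from below. -/
theorem rpValue_one_of_drpFeasible {v : Finset (Fin n) → ℝ} {Fam : Finset (Finset (Fin n))}
    {x : Fin n → ℝ} {ε : ℝ} {d : Fin n → ℝ} (hx : ∀ S, S ∉ Fam → v S + ε ≤ pay x S)
    (hd : DRPFeasible v Fam x ε d 1) : RPValue v Fam x ε 1 := by
  refine ⟨⟨0, by simp, by simp, by simp, by simp, zero_le_one⟩, ?_⟩
  rintro δ ⟨y, h1, h2, h3, h4, h5⟩
  have h0 := sum_mul_pay_eq_zero h1 d
  rw [← Finset.sum_filter_add_sum_filter_not Finset.univ (fun T => T ∈ Fam)] at h0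
  have h6 : ∑ T with T ∈ Fam, y T * pay d T = 0 :=
    Finset.sum_eq_zero fun T hT => by rw [hd.2.1 T (Finset.mem_filter.1 hT).2, mul_zero]
  -- A nonzero `y T` forces `T` to be tight, where the direction gains at least `1`; balancedness
  -- then leaves total weight at most `0`.
  have h7 : ∑ T with T ∉ Fam, y T ≤ ∑ T with T ∉ Fam, y T * pay d T :=
    Finset.sum_le_sum fun T hT => by
      have hT := (Finset.mem_filter.1 hT).2
      rcases (hx T hT).lt_or_eq with h | h
      · simp [h4 T hT h]
      · exact le_mul_of_one_le_right (h3 T hT) (hd.1 T hT h.symm)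
  linarith

end Coop

/-! ### Values of coalitions. -/

namespace SingleMarket

open Coop

variable {n : ℕ}

/-- Players are numbered by increasing cost, so `j` is a cheapest producer in `S`; without capacity
bounds it can serve the whole demand. -/
theorem v_eq_of_min (G : SingleMarket n) {S : Finset (Fin n)} {j : Fin n} (hj : j ∈ S)
    (hmin : ∀ i ∈ S, j ≤ i) : G.v S = (G.r - G.c j) * pay G.share S := by
  refine IsGreatest.csSup_eq ⟨⟨fun i _ => if i = j then pay G.share S else 0, ⟨?_, ?_, ?_⟩, ?_⟩, ?_⟩
  · intro _
    simp [hj, toGame, pay]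
  · intro i _
    exact le_top
  · intro i _ _
    dsimp only
    split_ifs
    · exact Finset.sum_nonneg fun i _ => G.share_nonneg i
    · exact le_rfl
  · simp [hj, toGame]
  · rintro p ⟨y, ⟨h1, -, h3⟩, rfl⟩
    have h1 := h1 ()
    simp only [toGame, Finset.univ_unique, PUnit.default_eq_unit, Finset.sum_singleton] at h1 ⊢
    calc ∑ i ∈ S, (G.r - G.c i) * y i () ≤ ∑ i ∈ S, (G.r - G.c j) * y i () :=
          Finset.sum_le_sum fun i hi => mul_le_mul_of_nonneg_right
            (by linarith [G.c_mono (hmin i hi)]) (h3 i hi ())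
      _ = (G.r - G.c j) * ∑ i ∈ S, y i () := by rw [Finset.mul_sum]
      _ ≤ _ := mul_le_mul_of_nonneg_left h1 (by linarith [G.c_le j])

theorem v_empty (G : SingleMarket n) : G.v ∅ = 0 := by
  refine IsGreatest.csSup_eq ⟨⟨0, ⟨by simp, by simp, by simp⟩, by simp⟩, ?_⟩
  rintro p ⟨y, -, rfl⟩
  simp

theorem pay_share_nonneg (G : SingleMarket n) (S : Finset (Fin n)) : 0 ≤ pay G.share S :=
  Finset.sum_nonneg fun i _ => G.share_nonneg i

theorem exists_v_eq (G : SingleMarket n) {S : Finset (Fin n)} (hS : S.Nonempty) :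
    ∃ j ∈ S, G.v S = (G.r - G.c j) * pay G.share S :=
  ⟨S.min' hS, S.min'_mem hS, G.v_eq_of_min (S.min'_mem hS) fun i hi => S.min'_le i hi⟩

/-- Together with `exists_v_eq` this makes the value a maximum over members `j`. A wrong guess of
`j` underestimates the value, which is harmless when ratios are minimised. -/
theorem le_v (G : SingleMarket n) {S : Finset (Fin n)} {j : Fin n} (hj : j ∈ S) :
    (G.r - G.c j) * pay G.share S ≤ G.v S := by
  rw [G.v_eq_of_min (S.min'_mem ⟨j, hj⟩) fun i hi => S.min'_le i hi]
  exact mul_le_mul_of_nonneg_right (by linarith [G.c_mono (S.min'_le j hj)]) (G.pay_share_nonneg S)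

variable [NeZero n]

theorem v_eq_of_zero_mem (G : SingleMarket n) {S : Finset (Fin n)} (h : 0 ∈ S) :
    G.v S = (G.r - G.c 0) * pay G.share S :=
  G.v_eq_of_min h fun i _ => Fin.zero_le i

theorem v_le (G : SingleMarket n) (S : Finset (Fin n)) :
    G.v S ≤ (G.r - G.c 0) * pay G.share S := by
  rcases S.eq_empty_or_nonempty with rfl | hS
  · simp [v_empty, pay]
  · obtain ⟨j, -, h⟩ := G.exists_v_eq hS
    rw [h]
    exact mul_le_mul_of_nonneg_right (by linarith [G.c_mono (Fin.zero_le j)])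
      (G.pay_share_nonneg S)

/-! ### Fixed families, the dual direction and dual certificates. -/

omit [NeZero n] in
theorem mem_fam {F S : Finset (Fin n)} : S ∈ fam F ↔ S ⊆ F ∨ Sᶜ ⊆ F := by
  have h : Fᶜ ⊆ S ↔ Sᶜ ⊆ F := by rw [← compl_compl S, Finset.compl_subset_compl, compl_compl]
  rw [fam, Finset.mem_filter, h]
  simp

omit [NeZero n] in
theorem fam_empty : fam (∅ : Finset (Fin n)) = {∅, Finset.univ} := by
  ext S
  simp [mem_fam, Finset.subset_empty]

omit [NeZero n] in
theorem fam_mono {F F' : Finset (Fin n)} (h : F ⊆ F') : fam F ⊆ fam F' := fun _ hS =>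
  mem_fam.2 ((mem_fam.1 hS).imp (fun h' => h'.trans h) fun h' => h'.trans h)

omit [NeZero n] in
theorem univ_mem_fam (F : Finset (Fin n)) : Finset.univ ∈ fam F := by simp [mem_fam]

omit [NeZero n] in
theorem singleton_mem_fam {F : Finset (Fin n)} {i : Fin n} (h : i ∈ F) : {i} ∈ fam F := by
  simp [mem_fam, h]

theorem mem_candidates {F S : Finset (Fin n)} (hF : 0 ∉ F) :
    S ∈ candidates F ↔ ¬ S ⊆ F ∧ 0 ∉ S := by
  simp only [candidates, Finset.mem_filter, Finset.mem_univ, true_and, mem_fam, not_or]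
  constructor
  · rintro ⟨⟨h, -⟩, h'⟩
    exact ⟨h, h'⟩
  · rintro ⟨h, h'⟩
    exact ⟨⟨h, fun h0 => hF (h0 (Finset.mem_compl.2 h'))⟩, h'⟩

theorem compl_singleton_notMem_fam {F : Finset (Fin n)} (hF : 0 ∉ F) {i : Fin n} (hi : i ∉ F)
    (h0 : i ≠ 0) : {i}ᶜ ∉ fam F := by
  rw [mem_fam, compl_compl, Finset.singleton_subset_iff, not_or]
  exact ⟨fun h => hF (h (by simpa using h0.symm)), hi⟩

theorem pay_dir {F S : Finset (Fin n)} (h : 0 ∉ S) :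
    pay (dir F) S = -((S \ F).card : ℝ) := by
  have h1 : ∀ i ∈ S, dir F i = if i ∈ F then 0 else -1 := fun i hi => by
    rw [dir, if_neg fun h0 : i = 0 => h (h0 ▸ hi)]
  rw [pay, Finset.sum_congr rfl h1, Finset.sum_ite, Finset.filter_notMem_eq_sdiff]
  simp

/-- Player `0` collects the units lost by the others; since `0 ∉ F`, there are `n - 1 - |F|` of
them. -/
theorem pay_dir_univ {F : Finset (Fin n)} (hF : 0 ∉ F) : pay (dir F) Finset.univ = 0 := by
  have h := pay_compl (dir F) {0}
  rw [pay_dir (by simp)] at h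
  have h1 : pay (dir F) {0} = (n : ℝ) - 1 - F.card := by simp [pay, dir]
  have h2 : ((({0}ᶜ : Finset (Fin n)) \ F).card : ℝ) = (n : ℝ) - 1 - F.card := by
    have h3 : F ⊆ {0}ᶜ := by simpa using hF
    rw [Finset.cast_card_sdiff h3, Finset.card_compl, Nat.cast_sub (by simp [NeZero.one_le])]
    simp
  linarith

/-- The gain of `0` minus the losses inside `S` is one unit for each losing player left out of `S`.
-/
theorem pay_dir_of_zero_mem {F S : Finset (Fin n)} (hF : 0 ∉ F) (h : 0 ∈ S) :
    pay (dir F) S = ((Sᶜ \ F).card : ℝ) := by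
  have h1 := pay_compl (dir F) S
  rw [pay_dir (by simpa using h), pay_dir_univ hF] at h1
  linarith

theorem pay_dir_of_mem_fam {F S : Finset (Fin n)} (hF : 0 ∉ F) (h : S ∈ fam F) :
    pay (dir F) S = 0 := by
  rcases mem_fam.1 h with h | h
  · rw [pay_dir fun h0 => hF (h h0), Finset.sdiff_eq_empty_iff_subset.2 h]
    simp
  · rw [pay_dir_of_zero_mem hF (by_contra fun h0 => hF (h (Finset.mem_compl.2 h0))),
      Finset.sdiff_eq_empty_iff_subset.2 h]
    simp

theorem one_le_pay_dir {F S : Finset (Fin n)} (hF : 0 ∉ F) (h : 0 ∈ S) (hS : S ∉ fam F) :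
    1 ≤ pay (dir F) S := by
  rw [pay_dir_of_zero_mem hF h, Nat.one_le_cast, Nat.one_le_iff_ne_zero, Ne,
    Finset.card_eq_zero, Finset.sdiff_eq_empty_iff_subset]
  exact fun h' => hS (mem_fam.2 (Or.inr h'))

/-- The solution of the primal program that proves optimality when `S` and the complements of
the members of `S \ F` are tight. -/
noncomputable def certificate (F S T : Finset (Fin n)) : ℝ :=
  ((if T = S then 1 else 0) + (∑ i ∈ S \ F, if T = {i}ᶜ then 1 else 0)
    - (∑ i ∈ S ∩ F, if T = {i} then 1 else 0)
    - ((S \ F).card : ℝ) * if T = Finset.univ then 1 else 0) / (1 + ((S \ F).card : ℝ))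

-- Pairing with a general `f` serves both equality constraints of the program: `f = pay x` gives
-- balancedness, the indicator of the unfixed coalitions gives total weight one.
omit [NeZero n] in
theorem sum_certificate_mul (F S : Finset (Fin n)) (f : Finset (Fin n) → ℝ) :
    ∑ T, certificate F S T * f T = (f S + ∑ i ∈ S \ F, f {i}ᶜ - ∑ i ∈ S ∩ F, f {i}
      - ((S \ F).card : ℝ) * f Finset.univ) / (1 + ((S \ F).card : ℝ)) := by
  simp only [certificate, div_mul_eq_mul_div, ← Finset.sum_div, sub_mul, add_mul,
    Finset.sum_sub_distrib, Finset.sum_add_distrib, Finset.sum_mul, mul_assoc, ← Finset.mul_sum]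
  rw [Finset.sum_comm (t := S \ F), Finset.sum_comm (t := S ∩ F)]
  simp

omit [NeZero n] in
theorem sum_certificate_mul_pay (F S : Finset (Fin n)) (x : Fin n → ℝ) :
    ∑ T, certificate F S T * pay x T = 0 := by
  have h1 : ∑ i ∈ S \ F, pay x {i}ᶜ =
      ((S \ F).card : ℝ) * pay x Finset.univ - ∑ i ∈ S \ F, x i := by
    simp only [pay_compl, Finset.sum_sub_distrib, Finset.sum_const, nsmul_eq_mul]
    simp [pay]
  have h2 : pay x S = ∑ i ∈ S \ F, x i + ∑ i ∈ S ∩ F, x i := by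
    rw [add_comm, Finset.sum_inter_add_sum_sdiff, pay]
  have h3 : ∑ i ∈ S ∩ F, pay x {i} = ∑ i ∈ S ∩ F, x i := by simp [pay]
  rw [sum_certificate_mul, h1, h2, h3, div_eq_zero_iff]
  left
  ring

omit [NeZero n] in
theorem certificate_of_notMem_fam {F S T : Finset (Fin n)} (hT : T ∉ fam F) :
    certificate F S T = ((if T = S then 1 else 0) + (∑ i ∈ S \ F, if T = {i}ᶜ then 1 else 0))
      / (1 + ((S \ F).card : ℝ)) := by
  have h1 : ∑ i ∈ S ∩ F, (if T = {i} then (1 : ℝ) else 0) = 0 :=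
    Finset.sum_eq_zero fun i hi => if_neg fun h : T = {i} =>
      hT (h ▸ singleton_mem_fam (Finset.mem_inter.1 hi).2)
  rw [certificate, h1, if_neg fun h : T = Finset.univ => hT (h ▸ univ_mem_fam F)]
  simp

theorem pFeasible_certificate {F S : Finset (Fin n)} (hF : 0 ∉ F) (hS : S ∈ candidates F) :
    PFeasible (fam F) (certificate F S) := by
  have hS' := (mem_candidates hF).1 hS
  refine ⟨fun i => ?_, ?_, fun T hT => ?_⟩
  -- Balancedness at `i` is the pairing with the payoffs of the `i`-th unit vector.
  · have h := sum_certificate_mul_pay F S (Pi.single i (1 : ℝ))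
    simp only [pay_single, mul_ite, mul_one, mul_zero] at h
    rwa [Finset.sum_filter]
  · have h := sum_certificate_mul F S fun T => if T ∈ fam F then 0 else 1
    simp only [mul_ite, mul_one, mul_zero] at h
    have h1 : ∑ i ∈ S \ F, (if ({i}ᶜ : Finset (Fin n)) ∈ fam F then (0 : ℝ) else 1) =
        ((S \ F).card : ℝ) := by
      rw [Finset.sum_congr rfl fun i hi => if_neg (compl_singleton_notMem_fam hF
        (Finset.mem_sdiff.1 hi).2 fun h0 => hS'.2 (h0 ▸ (Finset.mem_sdiff.1 hi).1))]
      simp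
    have h2 : ∑ i ∈ S ∩ F, (if ({i} : Finset (Fin n)) ∈ fam F then (0 : ℝ) else 1) = 0 :=
      Finset.sum_eq_zero fun i hi => if_pos (singleton_mem_fam (Finset.mem_inter.1 hi).2)
    -- `S` and the complements of singletons are unfixed, the singletons and the grand coalition are
    -- fixed, so numerator and denominator coincide.
    rw [h1, h2, if_neg (Finset.mem_filter.1 hS).2.1, if_pos (univ_mem_fam F), sub_zero,
      sub_zero, div_self (by positivity)] at h
    rw [Finset.sum_filter, ← h]
    exact Finset.sum_congr rfl fun T _ => by split_ifs <;> simp_all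
  · rw [certificate_of_notMem_fam hT]
    refine div_nonneg (add_nonneg ?_ (Finset.sum_nonneg fun i _ => ?_)) (by positivity) <;>
      split_ifs <;> norm_num

omit [NeZero n] in
theorem certificate_pos {F S T : Finset (Fin n)} (hT : T ∉ fam F)
    (h : T = S ∨ ∃ i ∈ S \ F, T = {i}ᶜ) : 0 < certificate F S T := by
  have h0 : ∀ i ∈ S \ F, (0 : ℝ) ≤ if T = {i}ᶜ then 1 else 0 := fun i _ => by
    split_ifs <;> norm_num
  rw [certificate_of_notMem_fam hT]
  refine div_pos ?_ (by positivity)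
  rcases h with h | ⟨i, hi, h⟩
  · rw [if_pos h]
    linarith [Finset.sum_nonneg h0]
  · have h1 := Finset.single_le_sum h0 hi
    rw [if_pos h] at h1
    split_ifs <;> linarith

omit [NeZero n] in
theorem certificate_eq_zero {F S T : Finset (Fin n)} (hT : T ∉ fam F)
    (h1 : T ≠ S) (h2 : ∀ i ∈ S \ F, T ≠ {i}ᶜ) : certificate F S T = 0 := by
  rw [certificate_of_notMem_fam hT, if_neg h1, Finset.sum_eq_zero fun i hi => if_neg (h2 i hi)]
  simp

/-- A feasible point at which `S` and the complements of the members of `S \ F` are tight is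
optimal, as certified. -/
theorem optimal_of_tight {v : Finset (Fin n) → ℝ} {c : Finset (Fin n) → ℝ}
    {F S : Finset (Fin n)} (hF : 0 ∉ F) (hS : S ∈ candidates F) {x : Fin n → ℝ} {ε : ℝ}
    (hx : DFeasible v (fam F) c x ε) (hxS : pay x S = v S + ε)
    (hxi : ∀ i ∈ S \ F, pay x {i}ᶜ = v {i}ᶜ + ε) :
    RPValue v (fam F) x ε 0 ∧ DOptimal v (fam F) c x ε ∧
      POptimal v (fam F) c (certificate F S) ∧
      PObjective v (fam F) c (certificate F S) = ε := by
  have hy := pFeasible_certificate hF hS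
  have hz : ∀ T, T ∉ fam F → v T + ε < pay x T → certificate F S T = 0 := fun T hT hlt =>
    certificate_eq_zero hT (fun h => by rw [h, hxS] at hlt; exact lt_irrefl _ hlt)
      fun i hi h => by rw [h, hxi i hi] at hlt; exact lt_irrefl _ hlt
  -- The unfixed part of the support is tight, so every term of the duality gap vanishes.
  have ho : PObjective v (fam F) c (certificate F S) = ε := by
    have h := hy.gap (v := v) hx.2 ε
    rw [Finset.sum_eq_zero, sub_eq_zero] at h
    · exact h
    · intro T hT
      have hT := (Finset.mem_filter.1 hT).2
      rcases (hx.1 T hT).lt_or_eq with h | h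
      · rw [hz T hT h, zero_mul]
      · rw [← h, mul_eq_zero]
        right
        ring
  obtain ⟨h1, h2⟩ := optimal_of_objective_eq hy hx ho
  -- The same vector, with `δ = 0`, solves the restricted primal.
  exact ⟨⟨⟨_, hy.1, by rw [add_zero, hy.2.1], hy.2.2, hz, le_rfl⟩, fun δ h => h.choose_spec.2.2.2.2⟩,
    h1, h2, ho⟩

/-- Paying every share at the best unit profit gives a coalition exactly its value if it contains
`0`, and at least its value otherwise. -/
theorem inv_start (G : SingleMarket n) : G.Inv G.start := by
  have hp : ∀ S, pay G.start.x S = (G.r - G.c 0) * pay G.share S := fun S => by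
    simp [pay, start, Finset.sum_mul, mul_comm (G.r - G.c 0)]
  refine ⟨by simp [start], ⟨fun S _ => ?_, fun S _ => rfl⟩, fun i _ hi => ?_⟩
  · rw [hp]
    simpa [start] using G.v_le S
  · rw [hp, G.v_eq_of_zero_mem (by simpa using hi.symm)]
    simp [start]

/-! ### One round of the algorithm. -/

section Round

variable {G : SingleMarket n} {s s' : PDState n} {S : Finset (Fin n)}

theorem Inv.le_of_candidate (hs : G.Inv s) (hS : S ∈ candidates s.F) :
    G.v S + s.ε ≤ pay s.x S := hs.feasible.1 S (Finset.mem_filter.1 hS).2.1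

theorem Inv.ratio_nonneg (hs : G.Inv s) (hS : S ∈ candidates s.F) : 0 ≤ G.ratio s S :=
  div_nonneg (by linarith [hs.le_of_candidate hS]) (by positivity)

omit [NeZero n] in
theorem ratio_mul (G : SingleMarket n) (s : PDState n) (S : Finset (Fin n)) :
    G.ratio s S * (1 + ((S \ s.F).card : ℝ)) = pay s.x S - G.v S - s.ε :=
  div_mul_cancel₀ _ (by positivity)

omit [NeZero n] in
theorem le_ratio_iff (G : SingleMarket n) (s : PDState n) (S : Finset (Fin n)) (l : ℝ) :
    l ≤ G.ratio s S ↔ l * (1 + ((S \ s.F).card : ℝ)) ≤ pay s.x S - G.v S - s.ε :=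
  le_div_iff₀ (by positivity)

omit [NeZero n] in
theorem ratio_eq_zero_iff (G : SingleMarket n) (s : PDState n) (S : Finset (Fin n)) :
    G.ratio s S = 0 ↔ pay s.x S = G.v S + s.ε := by
  rw [ratio, div_eq_zero_iff, or_iff_left (by positivity)]
  constructor <;> intro h <;> linarith

theorem Inv.exists_candidate (hs : G.Inv s) (ht : ¬ Terminal s) : (candidates s.F).Nonempty := by
  have h1 : s.F ⊆ {0}ᶜ := by simpa using hs.first
  have h2 : ¬ ({0}ᶜ : Finset (Fin n)) ⊆ s.F := fun h => ht (h1.antisymm h)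
  exact ⟨{0}ᶜ, (mem_candidates hs.first).2 ⟨h2, by simp⟩⟩

theorem Inv.exists_round (hs : G.Inv s) (ht : ¬ Terminal s) :
    ∃ (S : Finset (Fin n)) (s' : PDState n), G.Round s S s' := by
  obtain ⟨S, hS, hm⟩ := Finset.exists_min_image _ (G.ratio s) (hs.exists_candidate ht)
  exact ⟨S, ⟨S ∪ s.F, fun i => s.x i + G.ratio s S * dir s.F i, s.ε + G.ratio s S⟩,
    ht, hS, hm, rfl, rfl, rfl⟩

/-- The step lengths that keep feasibility are those below all ratios. -/
theorem Inv.dFeasible_step_iff (hs : G.Inv s) {l : ℝ} (hl : 0 ≤ l) :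
    DFeasible G.v (fam s.F) (pay s.x) (fun i => s.x i + l * dir s.F i) (s.ε + l) ↔
      ∀ T ∈ candidates s.F, l ≤ G.ratio s T := by
  have hc : ∀ T ∈ candidates s.F, (l ≤ G.ratio s T ↔
      G.v T + (s.ε + l) ≤ pay (fun i => s.x i + l * dir s.F i) T) := fun T hT => by
    rw [le_ratio_iff, pay_add_mul, pay_dir ((mem_candidates hs.first).1 hT).2]
    constructor <;> intro h <;> linarith
  constructor
  · exact fun h T hT => (hc T hT).2 (h.1 T (Finset.mem_filter.1 hT).2.1)
  · refine fun h => ⟨fun T hT => ?_, fun T hT => ?_⟩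
    -- A coalition with `0` gains at least as fast as `ε`, so it never limits the step.
    · by_cases h0 : 0 ∈ T
      · have h1 := one_le_pay_dir hs.first h0 hT
        have h2 := hs.feasible.1 T hT
        rw [pay_add_mul]
        nlinarith
      · have hT' : T ∈ candidates s.F := by simp [candidates, hT, h0]
        exact (hc T hT').1 (h T hT')
    · rw [pay_add_mul, pay_dir_of_mem_fam hs.first hT, mul_zero, add_zero]

theorem Inv.optimal_of_tight_candidate (hs : G.Inv s)
    (h : ∃ S ∈ candidates s.F, pay s.x S = G.v S + s.ε) :
    RPValue G.v (fam s.F) s.x s.ε 0 ∧ DOptimal G.v (fam s.F) (pay s.x) s.x s.ε := by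
  obtain ⟨S, hS, hSt⟩ := h
  have h0 := ((mem_candidates hs.first).1 hS).2
  obtain ⟨h1, h2, -⟩ := optimal_of_tight hs.first hS hs.feasible hSt fun i hi =>
    hs.tight i (Finset.mem_sdiff.1 hi).2 fun h => h0 (h ▸ (Finset.mem_sdiff.1 hi).1)
  exact ⟨h1, h2⟩

/-- Without a tight candidate every tight unfixed coalition contains `0` and gains at least `1`,
which is also the cap on the objective. -/
theorem Inv.drpOptimal_dir (hs : G.Inv s)
    (h : ¬ ∃ S ∈ candidates s.F, pay s.x S = G.v S + s.ε) :
    RPValue G.v (fam s.F) s.x s.ε 1 ∧ DRPOptimal G.v (fam s.F) s.x s.ε (dir s.F) 1 := by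
  have hd : DRPFeasible G.v (fam s.F) s.x s.ε (dir s.F) 1 := by
    refine ⟨fun S hS hSt => ?_, fun S hS => pay_dir_of_mem_fam hs.first hS, le_rfl⟩
    by_cases h0 : 0 ∈ S
    · exact one_le_pay_dir hs.first h0 hS
    · exact absurd ⟨S, by simp [candidates, hS, h0], hSt⟩ h
  exact ⟨rpValue_one_of_drpFeasible hs.feasible.1 hd, hd, fun _ _ h' => h'.2.2⟩

theorem Round.isGreatest (hr : G.Round s S s') (hs : G.Inv s) :
    IsGreatest {l : ℝ | 0 ≤ l ∧ DFeasible G.v (fam s.F) (pay s.x)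
      (fun i => s.x i + l * dir s.F i) (s.ε + l)} (G.ratio s S) :=
  ⟨⟨hs.ratio_nonneg hr.mem, (hs.dFeasible_step_iff (hs.ratio_nonneg hr.mem)).2 hr.minimal⟩,
    fun _ h => (hs.dFeasible_step_iff h.1).1 h.2 S hr.mem⟩

theorem Round.ratio_pos_iff (hr : G.Round s S s') (hs : G.Inv s) :
    0 < G.ratio s S ↔ RPValue G.v (fam s.F) s.x s.ε 1 := by
  constructor
  · refine fun h => (hs.drpOptimal_dir ?_).1
    rintro ⟨T, hT, hTt⟩
    have := hr.minimal T hT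
    rw [(G.ratio_eq_zero_iff s T).2 hTt] at this
    linarith
  · refine fun h => (hs.ratio_nonneg hr.mem).lt_of_ne fun h0 => ?_
    have h1 := (hs.optimal_of_tight_candidate
      ⟨S, hr.mem, (G.ratio_eq_zero_iff s S).1 h0.symm⟩).1
    exact zero_ne_one (h1.unique h)

theorem Round.dFeasible (hr : G.Round s S s') (hs : G.Inv s) :
    DFeasible G.v (fam s.F) (pay s.x) s'.x s'.ε := by
  rw [hr.x_eq, hr.ε_eq]
  exact (hr.isGreatest hs).1.2

/-- Leaving out a single losing player gains exactly one unit, the rate of `ε`. The tightness that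
the certificates rely on thus survives every step. -/
theorem Round.tight (hr : G.Round s S s') (hs : G.Inv s) {i : Fin n} (hi : i ∉ s.F)
    (h0 : i ≠ 0) : pay s'.x {i}ᶜ = G.v {i}ᶜ + s'.ε := by
  have h1 : pay (dir s.F) {i}ᶜ = 1 := by
    rw [pay_dir_of_zero_mem hs.first (by simpa using h0.symm), compl_compl,
      Finset.sdiff_eq_self_of_disjoint (by simpa using hi)]
    simp
  rw [hr.x_eq, hr.ε_eq, pay_add_mul, hs.tight i hi h0, h1]
  ring

theorem Round.tight_self (hr : G.Round s S s') (hs : G.Inv s) :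
    pay s'.x S = G.v S + s'.ε := by
  rw [hr.x_eq, hr.ε_eq, pay_add_mul, pay_dir ((mem_candidates hs.first).1 hr.mem).2]
  linarith [G.ratio_mul s S]

theorem Round.optimal (hr : G.Round s S s') (hs : G.Inv s) :
    RPValue G.v (fam s.F) s'.x s'.ε 0 ∧ DOptimal G.v (fam s.F) (pay s.x) s'.x s'.ε ∧
      POptimal G.v (fam s.F) (pay s.x) (certificate s.F S) ∧
      PObjective G.v (fam s.F) (pay s.x) (certificate s.F S) = s'.ε :=
  optimal_of_tight hs.first hr.mem (hr.dFeasible hs) (hr.tight_self hs) fun _ hi =>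
    hr.tight hs (Finset.mem_sdiff.1 hi).2 fun h =>
      ((mem_candidates hs.first).1 hr.mem).2 (h ▸ (Finset.mem_sdiff.1 hi).1)

theorem Round.certificate_compl_pos (hr : G.Round s S s') (hs : G.Inv s) {i : Fin n}
    (hi : i ∈ S \ s.F) : {i}ᶜ ∉ fam s.F ∧ 0 < certificate s.F S {i}ᶜ := by
  have h := compl_singleton_notMem_fam hs.first (Finset.mem_sdiff.1 hi).2 fun h =>
    ((mem_candidates hs.first).1 hr.mem).2 (h ▸ (Finset.mem_sdiff.1 hi).1)
  exact ⟨h, certificate_pos h (Or.inr ⟨i, hi, rfl⟩)⟩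

theorem Round.ssubset (hr : G.Round s S s') (hs : G.Inv s) : s.F ⊂ s'.F := by
  rw [hr.F_eq]
  refine ⟨Finset.subset_union_right, fun h => ?_⟩
  exact ((mem_candidates hs.first).1 hr.mem).1 (Finset.subset_union_left.trans h)

theorem Round.inv (hr : G.Round s S s') (hs : G.Inv s) : G.Inv s' := by
  have hF : s.F ⊆ s'.F := (hr.ssubset hs).1
  -- Fixed values are reset to the new payoffs, so only inequalities remain, and these are among
  -- those of the old program.
  refine ⟨?_, ⟨fun T hT => (hr.dFeasible hs).1 T fun h => hT (fam_mono hF h), fun _ _ => rfl⟩,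
    fun i hi h0 => hr.tight hs (fun h => hi (hF h)) h0⟩
  rw [hr.F_eq, Finset.mem_union, not_or]
  exact ⟨((mem_candidates hs.first).1 hr.mem).2, hs.first⟩

end Round

end SingleMarket

/-! ### Lexicographic comparison of sorted multisets. -/

theorem Multiset.sort_cons_eq_orderedInsert {α : Type*} [LinearOrder α] (a : α) (s : Multiset α) :
    (a ::ₘ s).sort (· ≤ ·) = (s.sort (· ≤ ·)).orderedInsert (· ≤ ·) a :=
  List.Perm.eq_of_pairwise' (r := (· ≤ ·)) (Multiset.pairwise_sort _ _)
    ((Multiset.pairwise_sort s (· ≤ ·)).orderedInsert a _)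
    (Multiset.coe_eq_coe.1 (by
      rw [Multiset.sort_eq, Multiset.coe_eq_coe.2 (List.perm_orderedInsert _ _ _),
        ← Multiset.cons_coe, Multiset.sort_eq]))

/-- Equal lengths matter: `[]` precedes `[b]`, but inserting `a > b` gives `[a]` and `[b, a]`, in
the opposite order. -/
theorem List.Lex.orderedInsert {α : Type*} [LinearOrder α] {l l' : List α}
    (h : List.Lex (· < ·) l l') (hl : l.length = l'.length) (a : α) :
    List.Lex (· < ·) (l.orderedInsert (· ≤ ·) a) (l'.orderedInsert (· ≤ ·) a) := by
  induction h with
  | nil => simp at hl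
  | @rel c l d l' hcd =>
    by_cases h1 : a ≤ c
    · rw [List.orderedInsert_cons_of_le _ _ h1, List.orderedInsert_cons_of_le _ _ (h1.trans hcd.le)]
      exact .cons (.rel hcd)
    · rw [List.orderedInsert_of_not_le _ _ h1, List.orderedInsert_cons]
      split_ifs
      · exact .rel (not_le.1 h1)
      · exact .rel hcd
  | @cons c l l' h ih =>
    rw [List.orderedInsert_cons, List.orderedInsert_cons]
    split_ifs
    · exact .cons (.cons h)
    · exact .cons (ih (by simpa using hl))

/-- Common entries can be inserted one at a time; this allows the excesses of fixed coalitions to be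
ignored. -/
theorem Multiset.lex_sort_add {α : Type*} [LinearOrder α] {s t : Multiset α}
    (hst : s.card = t.card) (h : List.Lex (· < ·) (s.sort (· ≤ ·)) (t.sort (· ≤ ·)))
    (u : Multiset α) :
    List.Lex (· < ·) ((u + s).sort (· ≤ ·)) ((u + t).sort (· ≤ ·)) := by
  induction u using Multiset.induction with
  | empty => simpa using h
  | cons a u ih =>
    rw [Multiset.cons_add, Multiset.cons_add, Multiset.sort_cons_eq_orderedInsert,
      Multiset.sort_cons_eq_orderedInsert]
    exact ih.orderedInsert (by simp [hst]) a

/-- The first entries decide: the least element of `s` is below `e`, that of `t` is not. -/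
theorem Multiset.lex_sort_of_lt {α : Type*} [LinearOrder α] {s t : Multiset α} {a e : α}
    (ha : a ∈ s) (hae : a < e) (ht : ∀ b ∈ t, e ≤ b) (hst : s.card = t.card) :
    List.Lex (· < ·) (s.sort (· ≤ ·)) (t.sort (· ≤ ·)) := by
  have h1 := Multiset.pairwise_sort s (· ≤ ·)
  have h2 : ∀ b ∈ t.sort (· ≤ ·), e ≤ b := fun b hb => ht b ((Multiset.mem_sort _).1 hb)
  have h3 : a ∈ s.sort (· ≤ ·) := (Multiset.mem_sort _).2 ha
  have h4 : (s.sort (· ≤ ·)).length = (t.sort (· ≤ ·)).length := by simp [hst]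
  generalize s.sort (· ≤ ·) = l at *
  generalize t.sort (· ≤ ·) = l' at *
  cases l with
  | nil => simp at h3
  | cons c l =>
    cases l' with
    | nil => simp at h4
    | cons d l' =>
      have h5 : c ≤ a := by
        rcases List.mem_cons.1 h3 with h | h
        · exact h.ge
        · exact (List.pairwise_cons.1 h1).1 a h
      exact .rel (h5.trans_lt (hae.trans_le (h2 d (by simp))))

namespace Coop

variable {n : ℕ}

/-- The excesses on `Fam` are shared and cancel; among the others, `e` separates the least excess of
`y` from all those of `x`. -/
theorem leximinSuperior_of_lt {v : Finset (Fin n) → ℝ} {x y : Fin n → ℝ}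
    (Fam : Finset (Finset (Fin n))) (hFam : ∀ S ∈ Fam, pay y S = pay x S) {e : ℝ}
    (hx : ∀ S, S ∉ Fam → e ≤ pay x S - v S) {S : Finset (Fin n)} (hS : S ∈ proper n)
    (hSF : S ∉ Fam) (hy : pay y S - v S < e) : LeximinSuperior v x y := by
  have h : ∀ z : Fin n → ℝ, (proper n).val.map (fun S => pay z S - v S) =
      ((proper n).val.filter (· ∈ Fam)).map (fun S => pay z S - v S) +
        ((proper n).val.filter (· ∉ Fam)).map fun S => pay z S - v S := fun z => by
    rw [← Multiset.map_add, Multiset.filter_add_not]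
  have h1 : ((proper n).val.filter (· ∈ Fam)).map (fun S => pay y S - v S) =
      ((proper n).val.filter (· ∈ Fam)).map fun S => pay x S - v S :=
    Multiset.map_congr rfl fun T hT => by rw [hFam T (Multiset.mem_filter.1 hT).2]
  rw [LeximinSuperior, sortedExcess, sortedExcess, h, h, h1]
  have h2 : pay y S - v S ∈ ((proper n).val.filter (· ∉ Fam)).map fun S => pay y S - v S :=
    Multiset.mem_map_of_mem (fun S => pay y S - v S) (Multiset.mem_filter.2 ⟨hS, hSF⟩)
  refine Multiset.lex_sort_add (by simp)
    (Multiset.lex_sort_of_lt h2 hy (fun b hb => ?_) (by simp)) _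
  obtain ⟨T, hT, rfl⟩ := Multiset.mem_map.1 hb
  exact hx T (Multiset.mem_filter.1 hT).2

theorem nucleolus_eq_singleton {v : Finset (Fin n) → ℝ} {x : Fin n → ℝ}
    (hx : pay x Finset.univ = v Finset.univ)
    (h : ∀ y, pay y Finset.univ = v Finset.univ → y ≠ x → LeximinSuperior v x y) :
    nucleolus v = {x} := by
  ext y
  constructor
  · exact fun hy => by_contra fun hne => hy.2 ⟨x, hx, h y hy.1 hne⟩
  · rintro rfl
    refine ⟨hx, ?_⟩
    rintro ⟨z, hz, hzy⟩
    by_cases hne : z = y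
    · subst hne
      exact irrefl_of (List.Lex (· < ·)) _ hzy
    · exact asymm_of (List.Lex (· < ·)) hzy (h z hz hne)

end Coop

/-! ### Executions of the algorithm and the nucleolus. -/

namespace SingleMarket

open Coop

variable {n : ℕ} [NeZero n] {G : SingleMarket n}

section Round

variable {s s' : PDState n} {S : Finset (Fin n)}

theorem Round.pay_eq (hr : G.Round s S s') (hs : G.Inv s) {T : Finset (Fin n)}
    (hT : T ∈ fam s.F) : pay s'.x T = pay s.x T := (hr.dFeasible hs).2 T hT

theorem Round.le (hr : G.Round s S s') (hs : G.Inv s) : s.ε ≤ s'.ε := by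
  rw [hr.ε_eq]
  linarith [hs.ratio_nonneg hr.mem]

/-- The newly fixed coalitions have constant payoff on the optimal solutions. -/
theorem Round.pay_eq_of_optimal (hr : G.Round s S s') (hs : G.Inv s) {z : Fin n → ℝ}
    (hz : DOptimal G.v (fam s.F) (pay s.x) z s'.ε) {T : Finset (Fin n)} (hT : T ∈ fam s'.F) :
    pay z T = pay s'.x T := by
  obtain ⟨-, hx, hy, ho⟩ := hr.optimal hs
  have hu : pay z Finset.univ = pay s'.x Finset.univ := by
    rw [hr.pay_eq hs (univ_mem_fam _), hz.1.2 _ (univ_mem_fam _)]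
  have hi : ∀ i ∈ s'.F, z i = s'.x i := by
    intro i hi
    have hsing : ∀ w : Fin n → ℝ, pay w {i} = w i := fun w => by simp [pay]
    rw [← hsing z, ← hsing s'.x]
    by_cases hiF : i ∈ s.F
    · rw [hr.pay_eq hs (singleton_mem_fam hiF), hz.1.2 _ (singleton_mem_fam hiF)]
    · rw [hr.F_eq] at hi
      -- Positivity of the certificate makes `{i}ᶜ` tight at both points; as the totals agree, so do
      -- the coordinates at `i`.
      obtain ⟨h1, h2⟩ := hr.certificate_compl_pos hs
        (Finset.mem_sdiff.2 ⟨(Finset.mem_union.1 hi).resolve_right hiF, hiF⟩)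
      have h3 := hy.1.tight_of_pos (by rw [ho]; exact hz.1) h1 h2
      have h4 := hy.1.tight_of_pos (by rw [ho]; exact hx.1) h1 h2
      rw [pay_compl] at h3 h4
      linarith
  have hsub : ∀ U ⊆ s'.F, pay z U = pay s'.x U := fun U hU =>
    Finset.sum_congr rfl fun i hiU => hi i (hU hiU)
  rcases mem_fam.1 hT with h | h
  · exact hsub T h
  · have h1 := hsub _ h
    rw [pay_compl, pay_compl] at h1
    linarith

end Round

-- A player outside `F'` is needed, because `fam {i}ᶜ` already contains every coalition. The witness
-- of strictness is the singleton of a new player.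
omit [NeZero n] in
theorem fam_ssubset {F F' : Finset (Fin n)} (h : F ⊂ F') {z : Fin n} (hz : z ∉ F') :
    fam F ⊂ fam F' := by
  refine ⟨fam_mono h.1, fun h' => ?_⟩
  obtain ⟨i, hi, hiF⟩ := Finset.exists_of_ssubset h
  rcases mem_fam.1 (h' (singleton_mem_fam hi)) with h1 | h1
  · exact hiF (by simpa using h1)
  · exact hz (h.1 (h1 (by simpa using fun h0 : z = i => hz (h0 ▸ hi))))

section Run

variable {K : ℕ} {σ : ℕ → PDState n}

theorem IsRun.inv (h : G.IsRun K σ) : ∀ k ≤ K, G.Inv (σ k) := by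
  intro k
  induction k with
  | zero => exact fun _ => h.1 ▸ G.inv_start
  | succ k ih =>
    intro hk
    obtain ⟨S, hS⟩ := h.2 k hk
    exact hS.inv (ih (by omega))

theorem IsRun.le_card (h : G.IsRun K σ) : ∀ k ≤ K, k ≤ (σ k).F.card := by
  intro k
  induction k with
  | zero => simp
  | succ k ih =>
    intro hk
    obtain ⟨S, hS⟩ := h.2 k hk
    have h1 := Finset.card_lt_card (hS.ssubset (h.inv k (by omega)))
    have h2 := ih (by omega)
    omega

theorem IsRun.le (h : G.IsRun K σ) : K ≤ n - 1 := by
  have h1 : (σ K).F ⊆ {0}ᶜ := by simpa using (h.inv K le_rfl).first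
  have h2 := Finset.card_le_card h1
  rw [Finset.card_compl, Fintype.card_fin, Finset.card_singleton] at h2
  exact (h.le_card K le_rfl).trans h2

theorem IsRun.subset (h : G.IsRun K σ) {j k : ℕ} (hjk : j ≤ k) (hk : k ≤ K) :
    (σ j).F ⊆ (σ k).F := by
  induction k, hjk using Nat.le_induction with
  | base => exact subset_rfl
  | succ k hjk ih =>
    obtain ⟨S, hS⟩ := h.2 k hk
    exact (ih (by omega)).trans (hS.ssubset (h.inv k (by omega))).1

theorem IsRun.pay_eq (h : G.IsRun K σ) {j k : ℕ} (hjk : j ≤ k) (hk : k ≤ K)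
    {T : Finset (Fin n)} (hT : T ∈ fam (σ j).F) : pay (σ k).x T = pay (σ j).x T := by
  induction k, hjk using Nat.le_induction with
  | base => rfl
  | succ k hjk ih =>
    obtain ⟨S, hS⟩ := h.2 k hk
    rw [hS.pay_eq (h.inv k (by omega)) (fam_mono (h.subset hjk (by omega)) hT), ih (by omega)]

theorem IsRun.epsilon_le (h : G.IsRun K σ) {j k : ℕ} (hjk : j ≤ k) (hk : k ≤ K) :
    (σ j).ε ≤ (σ k).ε := by
  induction k, hjk using Nat.le_induction with
  | base => rfl
  | succ k hjk ih =>
    obtain ⟨S, hS⟩ := h.2 k hk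
    exact (ih (by omega)).trans (hS.le (h.inv k (by omega)))

/-- The excesses of the coalitions that are not fixed before round `j + 1` stay above the value
of that round. -/
theorem IsRun.excess_le (h : G.IsRun K σ) {j k : ℕ} (hjk : j + 1 ≤ k) (hk : k ≤ K)
    {T : Finset (Fin n)} (hT : T ∉ fam (σ j).F) : G.v T + (σ (j + 1)).ε ≤ pay (σ k).x T := by
  induction k, hjk using Nat.le_induction with
  | base =>
    obtain ⟨S, hS⟩ := h.2 j hk
    exact (hS.dFeasible (h.inv j (by omega))).1 T hT
  | succ k hjk ih =>
    obtain ⟨S, hS⟩ := h.2 k hk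
    have hi := h.inv k (by omega)
    -- Once fixed, `T` keeps its payoff; until then it obeys the bound with a later `ε`, which is no
    -- smaller.
    by_cases hTk : T ∈ fam (σ k).F
    · rw [hS.pay_eq hi hTk]
      exact ih (by omega)
    · have h1 := (hS.dFeasible hi).1 T hTk
      have h2 := h.epsilon_le (show j + 1 ≤ k + 1 by omega) hk
      linarith

theorem pay_start_univ (G : SingleMarket n) :
    pay G.start.x Finset.univ = G.v Finset.univ := by
  rw [G.v_eq_of_zero_mem (Finset.mem_univ 0)]
  simp [pay, start, Finset.sum_mul, mul_comm (G.r - G.c 0)]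

theorem Terminal.mem_fam {s : PDState n} (ht : Terminal s) (S : Finset (Fin n)) :
    S ∈ fam s.F := by
  rw [SingleMarket.mem_fam, show s.F = {0}ᶜ from ht]
  by_cases h : 0 ∈ S <;> simp [h]

omit [NeZero n] in
theorem eq_of_pay_eq {y z : Fin n → ℝ} (h : ∀ S, pay y S = pay z S) : y = z := by
  ext i
  simpa [pay] using h {i}

/-- Round `k` takes its program from `σ k` and its optimal solution from `σ (k + 1)`, hence the
shift in `x` and `ε`. -/
theorem IsRun.isRevisedMaschler (h : G.IsRun K σ) (ht : Terminal (σ K)) :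
    IsRevisedMaschler G.v K (fun k => fam (σ k).F) (fun k => pay (σ k).x)
      (fun k => (σ (k + 1)).x) (fun k => (σ (k + 1)).ε) where
  fam_zero := by
    rw [h.1]
    exact fam_empty
  val_univ := by
    rw [h.1]
    exact G.pay_start_univ
  val_empty := by simp [pay]
  optimal := fun k hk => by
    obtain ⟨S, hS⟩ := h.2 k hk
    exact (hS.optimal (h.inv k hk.le)).2.1
  grows := fun k hk => by
    obtain ⟨S, hS⟩ := h.2 k hk
    exact fam_ssubset (hS.ssubset (h.inv k hk.le)) (h.inv (k + 1) hk).first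
  extends_val := fun k hk T hT => h.pay_eq (Nat.le_succ k) hk hT
  fixed := fun k hk T hT z hz => by
    obtain ⟨S, hS⟩ := h.2 k hk
    exact hS.pay_eq_of_optimal (h.inv k hk.le) hz hT
  single := ⟨(σ K).x, fun _ _ => rfl, fun y hy => eq_of_pay_eq fun S => hy S (ht.mem_fam S)⟩

theorem IsRun.leximinSuperior (h : G.IsRun K σ) (ht : Terminal (σ K)) {y : Fin n → ℝ}
    (hy : pay y Finset.univ = G.v Finset.univ) (hne : y ≠ (σ K).x) :
    LeximinSuperior G.v (σ K).x y := by
  have h0 : ∀ T ∈ fam (σ 0).F, pay y T = pay (σ K).x T := by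
    intro T hT
    rw [h.pay_eq (Nat.zero_le K) le_rfl hT, h.1]
    rw [h.1, show G.start.F = ∅ from rfl, fam_empty] at hT
    rcases Finset.mem_insert.1 hT with rfl | hT
    · simp [pay]
    · rw [Finset.mem_singleton.1 hT, hy, G.pay_start_univ]
  -- The first round whose newly fixed payoffs distinguish `y` from the final point.
  obtain ⟨k, hk, hk1, hk2⟩ : ∃ k < K, (∀ T ∈ fam (σ k).F, pay y T = pay (σ K).x T) ∧
      ¬ ∀ T ∈ fam (σ (k + 1)).F, pay y T = pay (σ K).x T := by
    by_contra hcon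
    push Not at hcon
    have : ∀ k ≤ K, ∀ T ∈ fam (σ k).F, pay y T = pay (σ K).x T := by
      intro k
      induction k with
      | zero => exact fun _ => h0
      | succ k ih => exact fun hk => hcon k hk (ih (by omega))
    exact hne (eq_of_pay_eq fun S => this K le_rfl S (ht.mem_fam S))
  obtain ⟨S, hS⟩ := h.2 k hk
  have hi := h.inv k hk.le
  have hc : ∀ T ∈ fam (σ k).F, pay y T = pay (σ k).x T := fun T hT => by
    rw [hk1 T hT, h.pay_eq hk.le le_rfl hT]
  -- Otherwise `y` would be optimal in this round, and the newly fixed payoffs would agree.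
  obtain ⟨T, hT, hTlt⟩ : ∃ T, T ∉ fam (σ k).F ∧ pay y T < G.v T + (σ (k + 1)).ε := by
    by_contra hcon
    push Not at hcon
    refine hk2 fun T hT => ?_
    rw [hS.pay_eq_of_optimal hi ⟨⟨hcon, hc⟩, (hS.optimal hi).2.1.2⟩ hT,
      h.pay_eq (show k + 1 ≤ K from hk) le_rfl hT]
  refine leximinSuperior_of_lt (e := (σ (k + 1)).ε) (fam (σ k).F) hk1 (fun U hU => ?_) ?_ hT
    (by linarith)
  · have := h.excess_le (show k + 1 ≤ K from hk) le_rfl hU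
    linarith
  · rw [proper, Finset.mem_filter]
    refine ⟨Finset.mem_univ _, fun h => hT ?_, fun h => hT (h ▸ univ_mem_fam _)⟩
    simp [h, SingleMarket.mem_fam]

theorem IsRun.nucleolus_eq (h : G.IsRun K σ) (ht : Terminal (σ K)) :
    nucleolus G.v = {(σ K).x} := by
  refine nucleolus_eq_singleton ?_ fun y hy hne => h.leximinSuperior ht hy hne
  rw [h.pay_eq (Nat.zero_le K) le_rfl (univ_mem_fam _), h.1, G.pay_start_univ]

end Run

end SingleMarket

/-! ### A quadratic number of trials that contains a candidate of minimum ratio. -/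

namespace SingleMarket

open Coop

variable {n : ℕ}

/-- What `i` adds to the excess of a coalition whose value is estimated by the unit profit
of `j`. -/
noncomputable def weight (G : SingleMarket n) (s : PDState n) (j i : Fin n) : ℝ :=
  s.x i - (G.r - G.c j) * G.share i

theorem sum_weight (G : SingleMarket n) (s : PDState n) (j : Fin n) (S : Finset (Fin n)) :
    ∑ i ∈ S, G.weight s j i = pay s.x S - (G.r - G.c j) * pay G.share S := by
  simp [weight, pay, Finset.mul_sum]

variable [NeZero n]

open Classical in
/-- The coalitions among which a candidate of minimum ratio is sought: besides `j` and `p`, the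
members of `F` of negative weight and, if `b = 1`, the other players of weight at most that
of `p`. -/
noncomputable def trial (G : SingleMarket n) (s : PDState n) (j p : Fin n) (b : ℕ) :
    Finset (Fin n) :=
  Finset.univ.filter fun i => i = j ∨ i = p ∨ (i ∈ s.F ∧ G.weight s j i < 0) ∨
    (i ∉ s.F ∧ b = 1 ∧ i ≠ 0 ∧ G.weight s j i ≤ G.weight s j p)

/-- The unit profit of `j` is used even if the trial contains a cheaper producer. -/
noncomputable def trialRatio (G : SingleMarket n) (s : PDState n) (j p : Fin n) (b : ℕ) : ℝ :=
  (∑ i ∈ G.trial s j p b, G.weight s j i - s.ε) / (1 + ((G.trial s j p b \ s.F).card : ℝ))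

theorem mem_trial {G : SingleMarket n} {s : PDState n} {j p i : Fin n} {b : ℕ} :
    i ∈ G.trial s j p b ↔ i = j ∨ i = p ∨ (i ∈ s.F ∧ G.weight s j i < 0) ∨
      (i ∉ s.F ∧ b = 1 ∧ i ≠ 0 ∧ G.weight s j i ≤ G.weight s j p) := by
  simp [trial]

theorem trial_mem_candidates {G : SingleMarket n} {s : PDState n} (hF : 0 ∉ s.F) {j p : Fin n}
    (hj : j ≠ 0) (hp : p ≠ 0) (hpF : p ∉ s.F) (b : ℕ) : G.trial s j p b ∈ candidates s.F := by
  refine (mem_candidates hF).2 ⟨fun h => hpF (h (mem_trial.2 (Or.inr (Or.inl rfl)))), fun h => ?_⟩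
  rcases mem_trial.1 h with h | h | h | h
  · exact hj h.symm
  · exact hp h.symm
  · exact hF h.1
  · exact h.2.2.1 rfl

theorem ratio_trial_le (G : SingleMarket n) (s : PDState n) (j p : Fin n) (b : ℕ) :
    G.ratio s (G.trial s j p b) ≤ G.trialRatio s j p b := by
  rw [ratio, trialRatio, sum_weight]
  have := G.le_v (S := G.trial s j p b) (j := j) (mem_trial.2 (Or.inl rfl))
  gcongr

omit [NeZero n] in
theorem sum_le_sum_of_exchange {S T : Finset (Fin n)} {g : Fin n → ℝ}
    (h1 : ∀ i ∈ T, i ∉ S → g i ≤ 0) (h2 : ∀ i ∈ S, i ∉ T → 0 ≤ g i) :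
    ∑ i ∈ T, g i ≤ ∑ i ∈ S, g i := by
  rw [← Finset.sum_inter_add_sum_sdiff T S, ← Finset.sum_inter_add_sum_sdiff S T,
    Finset.inter_comm S T]
  have h3 : ∑ i ∈ T \ S, g i ≤ 0 := Finset.sum_nonpos fun i hi =>
    h1 i (Finset.mem_sdiff.1 hi).1 (Finset.mem_sdiff.1 hi).2
  have h4 : 0 ≤ ∑ i ∈ S \ T, g i := Finset.sum_nonneg fun i hi =>
    h2 i (Finset.mem_sdiff.1 hi).1 (Finset.mem_sdiff.1 hi).2
  linarith

/-- With `ρ = G.ratio s S`, a set has trial ratio at most `ρ` iff its weights, reduced by `ρ`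
outside `F`, sum to at most `ε + ρ`. `S` attains equality, so comparing reduced weights on the two
differences suffices. -/
theorem trialRatio_le {G : SingleMarket n} {s : PDState n} {j p : Fin n} {b : ℕ}
    {S : Finset (Fin n)} (hS : G.v S = (G.r - G.c j) * pay G.share S)
    (h1 : ∀ i ∈ G.trial s j p b, i ∉ S →
      G.weight s j i - (if i ∈ s.F then 0 else G.ratio s S) ≤ 0)
    (h2 : ∀ i ∈ S, i ∉ G.trial s j p b →
      0 ≤ G.weight s j i - (if i ∈ s.F then 0 else G.ratio s S)) :
    G.trialRatio s j p b ≤ G.ratio s S := by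
  have hsum : ∀ T : Finset (Fin n),
      ∑ i ∈ T, (G.weight s j i - (if i ∈ s.F then 0 else G.ratio s S)) =
        ∑ i ∈ T, G.weight s j i - G.ratio s S * ((T \ s.F).card : ℝ) := fun T => by
    rw [Finset.sum_sub_distrib, Finset.sum_ite, Finset.filter_notMem_eq_sdiff]
    simp [mul_comm]
  have h3 := sum_le_sum_of_exchange h1 h2
  rw [hsum, hsum] at h3
  have h4 := G.sum_weight s j S
  have h5 := G.ratio_mul s S
  rw [trialRatio, div_le_iff₀ (by positivity)]
  linarith

/-- Let `j` realise the value of `S`. Outsiders are worth including when their weight is at most the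
ratio of `S`, and the heaviest of these serves as `p`. If `S` has no such outsider, it still has
some outsider `q`, and with `b = 0` the trial has no outsiders except `q` and possibly `j`. -/
theorem exists_trialRatio_le {G : SingleMarket n} {s : PDState n} (hF : 0 ∉ s.F)
    {S : Finset (Fin n)} (hS : S ∈ candidates s.F) :
    ∃ j p : Fin n, ∃ b < 2, j ≠ 0 ∧ p ≠ 0 ∧ p ∉ s.F ∧ G.trialRatio s j p b ≤ G.ratio s S := by
  obtain ⟨hSF, h0⟩ := (mem_candidates hF).1 hS
  obtain ⟨q, hqS, hqF⟩ := Finset.not_subset.1 hSF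
  obtain ⟨j, hjS, hj⟩ := G.exists_v_eq ⟨q, hqS⟩
  have hne : ∀ i ∈ S, i ≠ 0 := fun i hi h => h0 (h ▸ hi)
  by_cases h : ∃ q ∈ S, q ∉ s.F ∧ G.weight s j q ≤ G.ratio s S
  · obtain ⟨q, hqS, hqF, hq⟩ := h
    classical
    obtain ⟨p, hp, hmax⟩ := Finset.exists_max_image
      (Finset.univ.filter fun i => i ∉ s.F ∧ i ≠ 0 ∧ G.weight s j i ≤ G.ratio s S)
      (G.weight s j) ⟨q, by simp [hqF, hne q hqS, hq]⟩
    simp only [Finset.mem_filter, Finset.mem_univ, true_and] at hp hmax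
    refine ⟨j, p, 1, one_lt_two, hne j hjS, hp.2.1, hp.1, trialRatio_le hj ?_ ?_⟩
    · intro i hi hiS
      rcases mem_trial.1 hi with rfl | rfl | hi | hi
      · exact absurd hjS hiS
      · rw [if_neg hp.1]
        linarith [hp.2.2]
      · rw [if_pos hi.1]
        linarith
      · rw [if_neg hi.1]
        linarith [hp.2.2]
    · intro i hiS hi
      rw [mem_trial] at hi
      push Not at hi
      split_ifs with hiF
      · linarith [hi.2.2.1 hiF]
      · have h1 := hi.2.2.2 hiF rfl (hne i hiS)
        by_contra hcon
        exact absurd (hmax i ⟨hiF, hne i hiS, by linarith⟩) (not_le.2 h1)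
  · push Not at h
    refine ⟨j, q, 0, two_pos, hne j hjS, hne q hqS, hqF, trialRatio_le hj ?_ ?_⟩
    · intro i hi hiS
      rcases mem_trial.1 hi with rfl | rfl | hi | hi
      · exact absurd hjS hiS
      · exact absurd hqS hiS
      · rw [if_pos hi.1]
        linarith
      · exact absurd hi.2.1 zero_ne_one
    · intro i hiS hi
      rw [mem_trial] at hi
      push Not at hi
      split_ifs with hiF
      · linarith [hi.2.2.1 hiF]
      · linarith [h i hiS hiF]

/-- A trial of minimum trial ratio is a candidate of minimum ratio. -/
theorem ratio_trial_of_minimal {G : SingleMarket n} {s : PDState n} (hF : 0 ∉ s.F)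
    {j p : Fin n} {b : ℕ} (hj : j ≠ 0) (hp : p ≠ 0) (hpF : p ∉ s.F)
    (hmin : ∀ j' p' : Fin n, ∀ b' < 2, j' ≠ 0 → p' ≠ 0 → p' ∉ s.F →
      G.trialRatio s j p b ≤ G.trialRatio s j' p' b') :
    G.ratio s (G.trial s j p b) = G.trialRatio s j p b ∧
      ∀ T ∈ candidates s.F, G.ratio s (G.trial s j p b) ≤ G.ratio s T := by
  have h : ∀ T ∈ candidates s.F, G.trialRatio s j p b ≤ G.ratio s T := fun T hT => by
    obtain ⟨j', p', b', hb', hj', hp', hpF', hle⟩ := exists_trialRatio_le hF hT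
    exact (hmin j' p' b' hb' hj' hp' hpF').trans hle
  have h1 := G.ratio_trial_le s j p b
  exact ⟨h1.antisymm (h _ (trial_mem_candidates hF hj hp hpF b)), fun T hT => h1.trans (h T hT)⟩

theorem round_trial {G : SingleMarket n} {s s' : PDState n} (hF : 0 ∉ s.F)
    {j p : Fin n} {b : ℕ} (hj : j ≠ 0) (hp : p ≠ 0) (hpF : p ∉ s.F)
    (hmin : ∀ j' p' : Fin n, ∀ b' < 2, j' ≠ 0 → p' ≠ 0 → p' ∉ s.F →
      G.trialRatio s j p b ≤ G.trialRatio s j' p' b')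
    (hs'F : s'.F = G.trial s j p b ∪ s.F)
    (hs'x : s'.x = fun i => s.x i + G.trialRatio s j p b * dir s.F i)
    (hs'ε : s'.ε = s.ε + G.trialRatio s j p b) : G.Round s (G.trial s j p b) s' := by
  obtain ⟨h1, h2⟩ := ratio_trial_of_minimal hF hj hp hpF hmin
  refine ⟨fun h => hpF ?_, trial_mem_candidates hF hj hp hpF b, h2, by rw [h1, hs'x],
    by rw [h1, hs'ε], hs'F⟩
  rw [show s.F = {0}ᶜ from h]
  simpa using hp

end SingleMarket

/-! ### Running time bounds and a program logic for the real RAM. -/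

namespace RealRAM

/-- A bound on the running time when every loop makes at most `n` iterations. -/
def Prog.work (n : ℕ) : Prog → ℕ
  | .skip => 1
  | .setNat _ i e => i.cost + e.cost + 1
  | .setReal _ i e => i.cost + e.cost + 1
  | .seq p p' => p.work n + p'.work n
  | .cond b p p' => b.cost + 1 + (p.work n + p'.work n)
  | .loop b p => n * (b.cost + 1 + p.work n) + (b.cost + 1)

/-- The nesting depth of the loops. -/
def Prog.depth : Prog → ℕ
  | .skip => 0
  | .setNat _ _ _ => 0
  | .setReal _ _ _ => 0
  | .seq p p' => max p.depth p'.depth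
  | .cond _ p p' => max p.depth p'.depth
  | .loop _ p => p.depth + 1

/-- Each level of nesting contributes a factor `n`; lower powers are absorbed because `n ≥ 1`. -/
theorem Prog.work_le {n : ℕ} (hn : 1 ≤ n) (p : Prog) : p.work n ≤ p.work 1 * n ^ p.depth := by
  induction p with
  | skip => simp [work, depth]
  | setNat => simp [work, depth]
  | setReal => simp [work, depth]
  | seq p p' ih ih' =>
    have h1 : n ^ p.depth ≤ n ^ max p.depth p'.depth := Nat.pow_le_pow_right hn (le_max_left _ _)
    have h2 : n ^ p'.depth ≤ n ^ max p.depth p'.depth := Nat.pow_le_pow_right hn (le_max_right _ _)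
    simp only [work, depth]
    nlinarith [Nat.mul_le_mul_left (p.work 1) h1, Nat.mul_le_mul_left (p'.work 1) h2]
  | cond b p p' ih ih' =>
    have h1 : n ^ p.depth ≤ n ^ max p.depth p'.depth := Nat.pow_le_pow_right hn (le_max_left _ _)
    have h2 : n ^ p'.depth ≤ n ^ max p.depth p'.depth := Nat.pow_le_pow_right hn (le_max_right _ _)
    have h3 : 1 ≤ n ^ max p.depth p'.depth := Nat.one_le_pow _ _ hn
    simp only [work, depth]
    nlinarith [Nat.mul_le_mul_left (p.work 1) h1, Nat.mul_le_mul_left (p'.work 1) h2,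
      Nat.mul_le_mul_left (b.cost + 1) h3]
  | loop b p ih =>
    have h1 : n ≤ n ^ (p.depth + 1) := Nat.le_self_pow (by omega) n
    have h2 : n * p.work n ≤ p.work 1 * n ^ (p.depth + 1) := by
      calc n * p.work n ≤ n * (p.work 1 * n ^ p.depth) := Nat.mul_le_mul_left n ih
        _ = p.work 1 * n ^ (p.depth + 1) := by ring
    simp only [work, depth]
    nlinarith [Nat.mul_le_mul_left (b.cost + 1) h1,
      Nat.mul_le_mul_left (b.cost + 1) (hn.trans h1)]

/-- Run `P` for the values `0, …, n - 1` of the variable in the array `a`. -/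
def forLoop (a : ℕ) (P : Prog) : Prog :=
  .seq (.setNat a (.const 0) (.const 0))
    (.loop (.natLt (.get a (.const 0)) (.get 0 (.const 0)))
      (.seq P (.setNat a (.const 0) (.add (.get a (.const 0)) (.const 1)))))

/-- The array whose only non-zero cell is the first one. -/
def cell {α : Type} [Zero α] (z : α) (i : ℕ) : α := if i = 0 then z else 0

@[simp] theorem cell_zero {α : Type} [Zero α] (z : α) : cell z 0 = z := rfl

theorem update_cell {α : Type} [Zero α] (z z' : α) :
    Function.update (cell z) 0 z' = cell z' := by
  ext i
  by_cases h : i = 0 <;> simp [cell, h]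

/-- The input of the nucleolus program, its output, and the log, whose last row is row `K` and
starts in the cells `base`. -/
structure Data where
  (n K base t : ℕ)
  F : ℕ → ℕ
  (c share out X E : ℕ → ℝ)
  r : ℝ

/-- The variables of the nucleolus program. -/
structure Store where
  d : Data
  (j p b i bj bp bb : ℕ)
  (num den best acc : ℝ)

namespace Store

def natArray (s : Store) : ℕ → ℕ → ℕ
  | 0 => cell s.d.n
  | 1 => cell s.d.K
  | 2 => s.d.F
  | 3 => cell s.d.base
  | 4 => cell s.d.t
  | 5 => cell s.j
  | 6 => cell s.p
  | 7 => cell s.b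
  | 8 => cell s.i
  | 9 => cell s.bj
  | 10 => cell s.bp
  | 11 => cell s.bb
  | _ => 0

def realArray (s : Store) : ℕ → ℕ → ℝ
  | 0 => cell s.d.r
  | 1 => s.d.c
  | 2 => s.d.share
  | 3 => s.d.out
  | 4 => s.d.X
  | 5 => s.d.E
  | 6 => cell s.num
  | 7 => cell s.den
  | 8 => cell s.best
  | 9 => cell s.acc
  | _ => 0

def mem (s : Store) : Mem := ⟨s.natArray, s.realArray⟩

/-- Turns an assignment to memory into a record update of the store, compared array by array. -/
theorem mem_setNat {s s' : Store} {a i k : ℕ} (hr : s'.realArray = s.realArray)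
    (ha : s'.natArray a = Function.update (s.natArray a) i k)
    (hn : ∀ a', a' ≠ a → s'.natArray a' = s.natArray a') : s.mem.setNat a i k = s'.mem := by
  simp only [mem, Mem.setNat, hr, Mem.mk.injEq, and_true]
  ext1 a'
  by_cases h : a' = a
  · subst h
    rw [Function.update_self, ha]
  · rw [Function.update_of_ne h, hn a' h]

theorem mem_setReal {s s' : Store} {a i : ℕ} {z : ℝ} (hr : s'.natArray = s.natArray)
    (ha : s'.realArray a = Function.update (s.realArray a) i z)
    (hn : ∀ a', a' ≠ a → s'.realArray a' = s.realArray a') : s.mem.setReal a i z = s'.mem := by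
  simp only [mem, Mem.setReal, hr, Mem.mk.injEq, true_and]
  ext1 a'
  by_cases h : a' = a
  · subst h
    rw [Function.update_self, ha]
  · rw [Function.update_of_ne h, hn a' h]

/-- Started in the store `s`, the program halts in a store with the property `Q`, within its
bound on the running time. -/
def Triple (n : ℕ) (P : Prog) (s : Store) (Q : Store → Prop) : Prop :=
  ∃ s' t, Exec P s.mem s'.mem t ∧ t ≤ P.work n ∧ Q s'

variable {n : ℕ} {s : Store} {Q Q' : Store → Prop}

theorem Triple.mono {P : Prog} (h : Triple n P s Q) (hQ : ∀ s', Q s' → Q' s') :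
    Triple n P s Q' := by
  obtain ⟨s', t, h1, h2, h3⟩ := h
  exact ⟨s', t, h1, h2, hQ s' h3⟩

theorem Triple.skip (h : Q s) : Triple n .skip s Q := ⟨s, 1, .skip _, le_rfl, h⟩

theorem Triple.seq {P P' : Prog} (h : Triple n P s fun s' => Triple n P' s' Q) :
    Triple n (.seq P P') s Q := by
  obtain ⟨s', t, h1, h2, s'', t', h3, h4, h5⟩ := h
  exact ⟨s'', t + t', .seq h1 h3, Nat.add_le_add h2 h4, h5⟩

theorem Triple.cond {b : BExpr} {P P' : Prog} (h : b.eval s.mem → Triple n P s Q)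
    (h' : ¬ b.eval s.mem → Triple n P' s Q) : Triple n (.cond b P P') s Q := by
  by_cases hb : b.eval s.mem
  · obtain ⟨s', t, h1, h2, h3⟩ := h hb
    exact ⟨s', _, .condTrue hb h1, by simp only [Prog.work]; omega, h3⟩
  · obtain ⟨s', t, h1, h2, h3⟩ := h' hb
    exact ⟨s', _, .condFalse hb h1, by simp only [Prog.work]; omega, h3⟩

theorem Triple.setNat {a : ℕ} {i e : NExpr} (s' : Store)
    (h : s.mem.setNat a (i.eval s.mem) (e.eval s.mem) = s'.mem) (hQ : Q s') :
    Triple n (.setNat a i e) s Q :=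
  ⟨s', _, h ▸ .setNat a i e s.mem, le_rfl, hQ⟩

theorem Triple.setReal {a : ℕ} {i : NExpr} {e : RExpr} (s' : Store)
    (h : s.mem.setReal a (i.eval s.mem) (e.eval s.mem) = s'.mem) (hQ : Q s') :
    Triple n (.setReal a i e) s Q :=
  ⟨s', _, h ▸ .setReal a i e s.mem, le_rfl, hQ⟩

/-- The guard is tied to the counter of the invariant, so the loop makes exactly `n` iterations. -/
theorem Triple.loop {b : BExpr} {P : Prog} (I : ℕ → Store → Prop) (h0 : I 0 s)
    (hb : ∀ k s, I k s → (b.eval s.mem ↔ k < n))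
    (hP : ∀ k < n, ∀ s, I k s → Triple n P s (I (k + 1))) : Triple n (.loop b P) s (I n) := by
  have h : ∀ d k s, k + d = n → I k s → ∃ s' t, Exec (.loop b P) s.mem s'.mem t ∧
      t ≤ d * (b.cost + 1 + P.work n) + (b.cost + 1) ∧ I n s' := by
    intro d
    induction d with
    | zero =>
      intro k s hk hI
      rw [add_zero] at hk
      subst hk
      exact ⟨s, _, .loopDone (by rw [hb _ _ hI]; exact lt_irrefl _), by simp, hI⟩
    | succ d ih =>
      intro k s hk hI
      obtain ⟨s', t, h1, h2, h3⟩ := hP k (by omega) s hI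
      obtain ⟨s'', t', h4, h5, h6⟩ := ih (k + 1) s' (by omega) h3
      refine ⟨s'', _, .loopStep ((hb k s hI).2 (by omega)) h1 h4, ?_, h6⟩
      rw [Nat.succ_mul]
      omega
  obtain ⟨s', t, h1, h2, h3⟩ := h n 0 s (by omega) h0
  exact ⟨s', t, h1, h2, h3⟩

/-! ### Assignment rules for the variables, and counting loops. -/

theorem Triple.set_K {e : NExpr} (h : Q { s with d := { s.d with K := e.eval s.mem } }) :
    Triple n (.setNat 1 (.const 0) e) s Q :=
  .setNat { s with d := { s.d with K := e.eval s.mem } }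
    (mem_setNat rfl (update_cell _ _).symm fun a' h => by
      unfold natArray; split <;> first | rfl | exact absurd rfl h) h

theorem Triple.set_base {e : NExpr} (h : Q { s with d := { s.d with base := e.eval s.mem } }) :
    Triple n (.setNat 3 (.const 0) e) s Q :=
  .setNat { s with d := { s.d with base := e.eval s.mem } }
    (mem_setNat rfl (update_cell _ _).symm fun a' h => by
      unfold natArray; split <;> first | rfl | exact absurd rfl h) h

theorem Triple.set_t {e : NExpr} (h : Q { s with d := { s.d with t := e.eval s.mem } }) :
    Triple n (.setNat 4 (.const 0) e) s Q :=
  .setNat { s with d := { s.d with t := e.eval s.mem } }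
    (mem_setNat rfl (update_cell _ _).symm fun a' h => by
      unfold natArray; split <;> first | rfl | exact absurd rfl h) h

theorem Triple.set_j {e : NExpr} (h : Q { s with j := e.eval s.mem }) :
    Triple n (.setNat 5 (.const 0) e) s Q :=
  .setNat { s with j := e.eval s.mem } (mem_setNat rfl (update_cell _ _).symm fun a' h => by
      unfold natArray; split <;> first | rfl | exact absurd rfl h) h

theorem Triple.set_p {e : NExpr} (h : Q { s with p := e.eval s.mem }) :
    Triple n (.setNat 6 (.const 0) e) s Q :=
  .setNat { s with p := e.eval s.mem } (mem_setNat rfl (update_cell _ _).symm fun a' h => by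
      unfold natArray; split <;> first | rfl | exact absurd rfl h) h

theorem Triple.set_b {e : NExpr} (h : Q { s with b := e.eval s.mem }) :
    Triple n (.setNat 7 (.const 0) e) s Q :=
  .setNat { s with b := e.eval s.mem } (mem_setNat rfl (update_cell _ _).symm fun a' h => by
      unfold natArray; split <;> first | rfl | exact absurd rfl h) h

theorem Triple.set_i {e : NExpr} (h : Q { s with i := e.eval s.mem }) :
    Triple n (.setNat 8 (.const 0) e) s Q :=
  .setNat { s with i := e.eval s.mem } (mem_setNat rfl (update_cell _ _).symm fun a' h => by
      unfold natArray; split <;> first | rfl | exact absurd rfl h) h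

theorem Triple.set_bj {e : NExpr} (h : Q { s with bj := e.eval s.mem }) :
    Triple n (.setNat 9 (.const 0) e) s Q :=
  .setNat { s with bj := e.eval s.mem } (mem_setNat rfl (update_cell _ _).symm fun a' h => by
      unfold natArray; split <;> first | rfl | exact absurd rfl h) h

theorem Triple.set_bp {e : NExpr} (h : Q { s with bp := e.eval s.mem }) :
    Triple n (.setNat 10 (.const 0) e) s Q :=
  .setNat { s with bp := e.eval s.mem } (mem_setNat rfl (update_cell _ _).symm fun a' h => by
      unfold natArray; split <;> first | rfl | exact absurd rfl h) h

theorem Triple.set_bb {e : NExpr} (h : Q { s with bb := e.eval s.mem }) :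
    Triple n (.setNat 11 (.const 0) e) s Q :=
  .setNat { s with bb := e.eval s.mem } (mem_setNat rfl (update_cell _ _).symm fun a' h => by
      unfold natArray; split <;> first | rfl | exact absurd rfl h) h

theorem Triple.set_num {e : RExpr} (h : Q { s with num := e.eval s.mem }) :
    Triple n (.setReal 6 (.const 0) e) s Q :=
  .setReal { s with num := e.eval s.mem } (mem_setReal rfl (update_cell _ _).symm fun a' h => by
      unfold realArray; split <;> first | rfl | exact absurd rfl h) h

theorem Triple.set_den {e : RExpr} (h : Q { s with den := e.eval s.mem }) :
    Triple n (.setReal 7 (.const 0) e) s Q :=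
  .setReal { s with den := e.eval s.mem } (mem_setReal rfl (update_cell _ _).symm fun a' h => by
      unfold realArray; split <;> first | rfl | exact absurd rfl h) h

theorem Triple.set_best {e : RExpr} (h : Q { s with best := e.eval s.mem }) :
    Triple n (.setReal 8 (.const 0) e) s Q :=
  .setReal { s with best := e.eval s.mem } (mem_setReal rfl (update_cell _ _).symm fun a' h => by
      unfold realArray; split <;> first | rfl | exact absurd rfl h) h

theorem Triple.set_acc {e : RExpr} (h : Q { s with acc := e.eval s.mem }) :
    Triple n (.setReal 9 (.const 0) e) s Q :=
  .setReal { s with acc := e.eval s.mem } (mem_setReal rfl (update_cell _ _).symm fun a' h => by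
      unfold realArray; split <;> first | rfl | exact absurd rfl h) h

theorem Triple.set_F {i : NExpr} {e : NExpr}
    (h : Q { s with d := { s.d with F := Function.update s.d.F (i.eval s.mem) (e.eval s.mem) } }) :
    Triple n (.setNat 2 i e) s Q :=
  .setNat { s with d := { s.d with F := Function.update s.d.F (i.eval s.mem) (e.eval s.mem) } }
    (mem_setNat rfl rfl fun a' h => by
      unfold natArray; split <;> first | rfl | exact absurd rfl h) h

theorem Triple.set_out {i : NExpr} {e : RExpr}
    (h : Q { s with d :=
      { s.d with out := Function.update s.d.out (i.eval s.mem) (e.eval s.mem) } }) :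
    Triple n (.setReal 3 i e) s Q :=
  .setReal { s with d := { s.d with out := Function.update s.d.out (i.eval s.mem) (e.eval s.mem) } }
    (mem_setReal rfl rfl fun a' h => by
      unfold realArray; split <;> first | rfl | exact absurd rfl h) h

theorem Triple.set_X {i : NExpr} {e : RExpr}
    (h : Q { s with d := { s.d with X := Function.update s.d.X (i.eval s.mem) (e.eval s.mem) } }) :
    Triple n (.setReal 4 i e) s Q :=
  .setReal { s with d := { s.d with X := Function.update s.d.X (i.eval s.mem) (e.eval s.mem) } }
    (mem_setReal rfl rfl fun a' h => by
      unfold realArray; split <;> first | rfl | exact absurd rfl h) h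

theorem Triple.set_E {i : NExpr} {e : RExpr}
    (h : Q { s with d := { s.d with E := Function.update s.d.E (i.eval s.mem) (e.eval s.mem) } }) :
    Triple n (.setReal 5 i e) s Q :=
  .setReal { s with d := { s.d with E := Function.update s.d.E (i.eval s.mem) (e.eval s.mem) } }
    (mem_setReal rfl rfl fun a' h => by
      unfold realArray; split <;> first | rfl | exact absurd rfl h) h

theorem Triple.for_i {P : Prog} (I : ℕ → Store → Prop)
    (hI : ∀ k s, I k s → s.i = k ∧ s.d.n = n) (h0 : I 0 { s with i := 0 })
    (hP : ∀ k < n, ∀ s, I k s → Triple n P s fun s' => I (k + 1) { s' with i := s'.i + 1 }) :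
    Triple n (forLoop 8 P) s (I n) :=
  .seq <| .set_i <| .loop I h0
    (fun k s h => by
      obtain ⟨h1, h2⟩ := hI k s h
      simp [BExpr.eval, NExpr.eval, mem, natArray, h1, h2])
    fun k hk s h => .seq <| (hP k hk s h).mono fun _ h' => .set_i h'

theorem Triple.for_j {P : Prog} (I : ℕ → Store → Prop)
    (hI : ∀ k s, I k s → s.j = k ∧ s.d.n = n) (h0 : I 0 { s with j := 0 })
    (hP : ∀ k < n, ∀ s, I k s → Triple n P s fun s' => I (k + 1) { s' with j := s'.j + 1 }) :
    Triple n (forLoop 5 P) s (I n) :=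
  .seq <| .set_j <| .loop I h0
    (fun k s h => by
      obtain ⟨h1, h2⟩ := hI k s h
      simp [BExpr.eval, NExpr.eval, mem, natArray, h1, h2])
    fun k hk s h => .seq <| (hP k hk s h).mono fun _ h' => .set_j h'

theorem Triple.for_p {P : Prog} (I : ℕ → Store → Prop)
    (hI : ∀ k s, I k s → s.p = k ∧ s.d.n = n) (h0 : I 0 { s with p := 0 })
    (hP : ∀ k < n, ∀ s, I k s → Triple n P s fun s' => I (k + 1) { s' with p := s'.p + 1 }) :
    Triple n (forLoop 6 P) s (I n) :=
  .seq <| .set_p <| .loop I h0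
    (fun k s h => by
      obtain ⟨h1, h2⟩ := hI k s h
      simp [BExpr.eval, NExpr.eval, mem, natArray, h1, h2])
    fun k hk s h => .seq <| (hP k hk s h).mono fun _ h' => .set_p h'

theorem Triple.for_t {P : Prog} (I : ℕ → Store → Prop)
    (hI : ∀ k s, I k s → s.d.t = k ∧ s.d.n = n) (h0 : I 0 { s with d := { s.d with t := 0 } })
    (hP : ∀ k < n, ∀ s, I k s → Triple n P s fun s' =>
      I (k + 1) { s' with d := { s'.d with t := s'.d.t + 1 } }) :
    Triple n (forLoop 4 P) s (I n) :=
  .seq <| .set_t <| .loop I h0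
    (fun k s h => by
      obtain ⟨h1, h2⟩ := hI k s h
      simp [BExpr.eval, NExpr.eval, mem, natArray, h1, h2])
    fun k hk s h => .seq <| (hP k hk s h).mono fun _ h' => .set_t h'

end Store

end RealRAM

/-! ### The nucleolus program and the specifications of its pieces. -/

namespace RealRAM

namespace Data

def weight (d : Data) (j i : ℕ) : ℝ := d.X (d.base + i) - (d.r - d.c j) * d.share i

def Joins (d : Data) (j p b i : ℕ) : Prop :=
  i = j ∨ i = p ∨ (d.F (d.base + i) = 1 ∧ d.weight j i < 0) ∨
    (d.F (d.base + i) ≠ 1 ∧ b = 1 ∧ i ≠ 0 ∧ d.weight j i ≤ d.weight j p)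

-- The parameter `k` counts the players already scanned, so that partial sums can serve as loop
-- invariants.
open Classical in
noncomputable def num (d : Data) (j p b k : ℕ) : ℝ :=
  0 - d.E d.K + ∑ i ∈ Finset.range k, if d.Joins j p b i then d.weight j i else 0

open Classical in
noncomputable def den (d : Data) (j p b k : ℕ) : ℝ :=
  1 + ∑ i ∈ Finset.range k, if d.Joins j p b i ∧ d.F (d.base + i) ≠ 1 then 1 else 0

noncomputable def trialRatio (d : Data) (j p b : ℕ) : ℝ := d.num j p b d.n / d.den j p b d.n

def Valid (d : Data) (j p : ℕ) : Prop := j ≠ 0 ∧ p ≠ 0 ∧ d.F (d.base + p) ≠ 1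

/-- `best` is the smallest trial ratio over the parameters in `V` and is attained by
`(bj, bp, bb)`, unless `bp = 0` and no trial has been made. -/
def IsBest (d : Data) (V : ℕ → ℕ → ℕ → Prop) (bj bp bb : ℕ) (best : ℝ) : Prop :=
  (∀ j p b, V j p b → d.Valid j p → bp ≠ 0 ∧ best ≤ d.trialRatio j p b) ∧
    (bp ≠ 0 → d.Valid bj bp ∧ bj < d.n ∧ bp < d.n ∧ best = d.trialRatio bj bp bb)

theorem IsBest.congr {d : Data} {V V' : ℕ → ℕ → ℕ → Prop} {bj bp bb : ℕ} {best : ℝ}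
    (h : d.IsBest V bj bp bb best) (hV : ∀ j p b, V' j p b → d.Valid j p → V j p b) :
    d.IsBest V' bj bp bb best :=
  ⟨fun j p b hV' hv => h.1 j p b (hV j p b hV' hv) hv, h.2⟩

end Data

def BExpr.or (b b' : BExpr) : BExpr := .neg (.conj (.neg b) (.neg b'))

theorem BExpr.eval_or (b b' : BExpr) (m : Mem) : (b.or b').eval m ↔ b.eval m ∨ b'.eval m := by
  simp only [BExpr.or, BExpr.eval]
  tauto

namespace NucleolusProgram

def nVar (a : ℕ) : NExpr := .get a (.const 0)

def rVar (a : ℕ) : RExpr := .get a (.const 0)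

def inF (i : NExpr) : BExpr := .natEq (.get 2 (.add (nVar 3) i)) (.const 1)

def weight (j i : NExpr) : RExpr :=
  .sub (.get 4 (.add (nVar 3) i)) (.mul (.sub (rVar 0) (.get 1 j)) (.get 2 i))

def joins : BExpr :=
  .or (.natEq (nVar 8) (nVar 5)) <| .or (.natEq (nVar 8) (nVar 6)) <|
    .or (.conj (inF (nVar 8)) (.realLt (weight (nVar 5) (nVar 8)) (.const 0))) <|
      .conj (.neg (inF (nVar 8))) <| .conj (.natEq (nVar 7) (.const 1)) <|
        .conj (.neg (.natEq (nVar 8) (.const 0)))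
          (.neg (.realLt (weight (nVar 5) (nVar 6)) (weight (nVar 5) (nVar 8))))

/-- Compute the numerator and the denominator of the trial ratio. -/
def evalTrial : Prog :=
  .seq (.setReal 6 (.const 0) (.sub (.const 0) (.get 5 (nVar 1)))) <|
  .seq (.setReal 7 (.const 0) (.const 1)) <|
  forLoop 8 <| .cond joins
    (.seq (.setReal 6 (.const 0) (.add (rVar 6) (weight (nVar 5) (nVar 8))))
      (.cond (inF (nVar 8)) .skip (.setReal 7 (.const 0) (.add (rVar 7) (.const 1)))))
    .skip

/-- Make a trial and keep it if it is the best one so far. -/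
def makeTrial : Prog :=
  .seq evalTrial <|
  .cond (.or (.natEq (nVar 10) (.const 0)) (.realLt (.div (rVar 6) (rVar 7)) (rVar 8)))
    (.seq (.setReal 8 (.const 0) (.div (rVar 6) (rVar 7))) <|
     .seq (.setNat 9 (.const 0) (nVar 5)) <|
     .seq (.setNat 10 (.const 0) (nVar 6)) (.setNat 11 (.const 0) (nVar 7)))
    .skip

/-- Find the best trial. -/
def search : Prog :=
  -- Player `0` is never a valid `p`, so `0` can signal that no trial has been made.
  .seq (.setNat 10 (.const 0) (.const 0)) <|
  forLoop 5 <| forLoop 6 <|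
    .cond (.conj (.neg (.natEq (nVar 5) (.const 0)))
        (.conj (.neg (.natEq (nVar 6) (.const 0))) (.neg (inF (nVar 6)))))
      (.seq (.setNat 7 (.const 0) (.const 0)) <| .seq makeTrial <|
       .seq (.setNat 7 (.const 0) (.const 1)) makeTrial)
      .skip

/-- Append to the log the state that the best trial leads to. -/
def update : Prog :=
  .seq (.setNat 5 (.const 0) (nVar 9)) <|
  .seq (.setNat 6 (.const 0) (nVar 10)) <|
  .seq (.setNat 7 (.const 0) (nVar 11)) <|
  -- Array `9` accumulates the new payoff of player `0`: her old payoff plus one step length for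
  -- each player who loses it.
  .seq (.setReal 9 (.const 0) (.get 4 (nVar 3))) <|
  .seq (forLoop 8 <|
    .seq (.cond (.or (inF (nVar 8)) joins)
      (.setNat 2 (.add (.add (nVar 3) (nVar 0)) (nVar 8)) (.const 1))
      (.setNat 2 (.add (.add (nVar 3) (nVar 0)) (nVar 8)) (.const 0))) <|
    .cond (.or (inF (nVar 8)) (.natEq (nVar 8) (.const 0)))
      (.setReal 4 (.add (.add (nVar 3) (nVar 0)) (nVar 8)) (.get 4 (.add (nVar 3) (nVar 8))))
      (.seq (.setReal 4 (.add (.add (nVar 3) (nVar 0)) (nVar 8))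
          (.sub (.get 4 (.add (nVar 3) (nVar 8))) (rVar 8)))
        (.setReal 9 (.const 0) (.add (rVar 9) (rVar 8))))) <|
  .seq (.setReal 4 (.add (nVar 3) (nVar 0)) (rVar 9)) <|
  .seq (.setReal 5 (.add (nVar 1) (.const 1)) (.add (.get 5 (nVar 1)) (rVar 8))) <|
  -- The offset of the last row is updated by addition, since naturals cannot be multiplied.
  .seq (.setNat 3 (.const 0) (.add (nVar 3) (nVar 0)))
    (.setNat 1 (.const 0) (.add (nVar 1) (.const 1)))

def round : Prog := .seq search (.cond (.natEq (nVar 10) (.const 0)) .skip update)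

/-- Of row `0` only the payoffs are written: zero memory already encodes `F = ∅` and `ε = 0`. Passes
of `round` after termination leave the log unchanged. -/
def main : Prog :=
  .seq (forLoop 8
    (.setReal 4 (nVar 8) (.mul (.get 2 (nVar 8)) (.sub (rVar 0) (.get 1 (.const 0)))))) <|
  .seq (forLoop 4 round) <|
  forLoop 8 (.setReal 3 (nVar 8) (.get 4 (.add (nVar 3) (nVar 8))))

end NucleolusProgram

namespace Store

open NucleolusProgram

variable {n : ℕ} {s : Store}

section Eval

variable (s : Store)

@[simp] theorem nat_mem : s.mem.nat = s.natArray := rfl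
@[simp] theorem real_mem : s.mem.real = s.realArray := rfl

@[simp] theorem eval_inF (i : NExpr) :
    (inF i).eval s.mem ↔ s.d.F (s.d.base + i.eval s.mem) = 1 := by
  simp [inF, nVar, BExpr.eval, NExpr.eval, natArray]

@[simp] theorem eval_weight (j i : NExpr) :
    (weight j i).eval s.mem = s.d.weight (j.eval s.mem) (i.eval s.mem) := by
  simp [weight, nVar, rVar, RExpr.eval, NExpr.eval, natArray, realArray, Data.weight]

@[simp] theorem eval_joins : joins.eval s.mem ↔ s.d.Joins s.j s.p s.b s.i := by
  simp [joins, nVar, BExpr.eval_or, BExpr.eval, NExpr.eval, RExpr.eval, natArray, Data.Joins]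

end Eval

theorem evalTrial_spec (hn : s.d.n = n) :
    Triple n evalTrial s fun s' => s' = { s with
      i := n, num := s.d.num s.j s.p s.b n, den := s.d.den s.j s.p s.b n } := by
  refine .seq <| .set_num <| .seq <| .set_den <| .for_i (fun k s' => s' = { s with
      i := k, num := s.d.num s.j s.p s.b k, den := s.d.den s.j s.p s.b k }) ?_ ?_ ?_
  · rintro k _ rfl
    exact ⟨rfl, hn⟩
  · simp [RExpr.eval, NExpr.eval, nVar, natArray, realArray, Data.num, Data.den]
  · rintro k hk _ rfl
    refine .cond (fun h => .seq <| .set_num <| .cond (fun h' => .skip ?_) fun h' => .set_den ?_)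
      fun h => .skip ?_
    all_goals
      simp only [eval_joins] at h
      try simp [NExpr.eval, nVar, natArray] at h'
      simp [*, RExpr.eval, NExpr.eval, nVar, rVar, natArray, realArray, Data.num, Data.den,
        Finset.sum_range_succ, add_assoc, -Finset.sum_boole]

theorem makeTrial_spec (hn : s.d.n = n) {V : ℕ → ℕ → ℕ → Prop}
    (hV : s.d.IsBest V s.bj s.bp s.bb s.best) (hv : s.d.Valid s.j s.p) (hj : s.j < n)
    (hp : s.p < n) :
    Triple n makeTrial s fun s' => s'.d = s.d ∧ s'.j = s.j ∧ s'.p = s.p ∧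
      s.d.IsBest (fun j p b => V j p b ∨ (j = s.j ∧ p = s.p ∧ b = s.b))
        s'.bj s'.bp s'.bb s'.best := by
  refine .seq <| (evalTrial_spec hn).mono ?_
  rintro _ rfl
  have ht : s.d.num s.j s.p s.b n / s.d.den s.j s.p s.b n = s.d.trialRatio s.j s.p s.b := by
    rw [Data.trialRatio, hn]
  refine .cond (fun h => .seq <| .set_best <| .seq <| .set_bj <| .seq <| .set_bp <| .set_bb ?_)
    fun h => .skip ?_
  all_goals
    simp only [BExpr.eval_or, BExpr.eval, NExpr.eval, RExpr.eval, nVar, rVar, nat_mem, real_mem,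
      natArray, realArray, cell_zero, ht] at h
  · simp only [NExpr.eval, RExpr.eval, nVar, rVar, nat_mem, real_mem, natArray, realArray,
      cell_zero, ht, true_and]
    refine ⟨?_, fun _ => ⟨hv, hn ▸ hj, hn ▸ hp, rfl⟩⟩
    rintro j p b (h1 | ⟨rfl, rfl, rfl⟩) h2
    · obtain ⟨h3, h4⟩ := hV.1 j p b h1 h2
      exact ⟨hv.2.1, ((h.resolve_left h3).le).trans h4⟩
    · exact ⟨hv.2.1, le_rfl⟩
  · refine ⟨rfl, rfl, rfl, ?_, hV.2⟩
    push Not at h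
    rintro j p b (h1 | ⟨rfl, rfl, rfl⟩) h2
    · exact hV.1 j p b h1 h2
    · exact h

theorem search_spec (hn : s.d.n = n) :
    Triple n search s fun s' => s'.d = s.d ∧
      s.d.IsBest (fun j p b => j < n ∧ p < n ∧ b < 2) s'.bj s'.bp s'.bb s'.best := by
  refine .seq <| .set_bp <| (Triple.for_j (fun k s' => (s'.j = k ∧ s'.d = s.d) ∧
    s.d.IsBest (fun j p b => j < k ∧ p < n ∧ b < 2) s'.bj s'.bp s'.bb s'.best)
    (fun k s' h => ⟨h.1.1, by rw [h.1.2, hn]⟩) ?_ ?_).mono fun s' h => ⟨h.1.2, h.2⟩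
  · simp [Data.IsBest, NExpr.eval]
  · rintro j hj s₁ ⟨⟨h1, h2⟩, hB⟩
    refine (Triple.for_p (fun k s' => (s'.p = k ∧ s'.j = j ∧ s'.d = s.d) ∧
      s.d.IsBest (fun j' p b => (j' < j ∧ p < n ∨ j' = j ∧ p < k) ∧ b < 2)
        s'.bj s'.bp s'.bb s'.best)
      (fun k s' h => ⟨h.1.1, by rw [h.1.2.2, hn]⟩) ?_ ?_).mono ?_
    · exact ⟨⟨rfl, h1, h2⟩, hB.congr fun j' p b h _ => by omega⟩
    · rintro p hp s₂ ⟨⟨h3, h4, h5⟩, hB⟩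
      refine .cond (fun h => .seq <| .set_b <| .seq ?_) fun h => .skip ?_
      all_goals
        simp only [BExpr.eval, eval_inF, NExpr.eval, nVar, nat_mem, natArray, cell_zero,
          h3, h4, h5] at h
      · refine (makeTrial_spec (V := fun j' p' b => (j' < j ∧ p' < n ∨ j' = j ∧ p' < p) ∧ b < 2)
          ?_ ?_ ?_ ?_ ?_).mono ?_
        · simp [h5, hn]
        · simpa [h5] using hB
        · simpa [h5, h4, h3, Data.Valid] using h
        · simpa [h4] using hj
        · simpa [h3] using hp
        · rintro s₃ ⟨h6, h7, h8, hB3⟩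
          simp only [h3, h4, h5, NExpr.eval] at h6 h7 h8 hB3
          refine .seq <| .set_b <| (makeTrial_spec
            (V := fun j' p' b => (j' < j ∧ p' < n ∨ j' = j ∧ p' < p) ∧ b < 2 ∨
              j' = j ∧ p' = p ∧ b = 0) ?_ ?_ ?_ ?_ ?_).mono ?_
          · simp [h6, hn]
          · simpa [h6] using hB3
          · simpa [h6, h7, h8, Data.Valid] using h
          · simpa [h7] using hj
          · simpa [h8] using hp
          · rintro s₄ ⟨h9, h10, h11, hB4⟩
            simp only [h6, h7, h8, NExpr.eval] at h9 h10 h11 hB4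
            exact ⟨⟨by simp [h11], h10, h9⟩, hB4.congr fun j' p' b h _ => by omega⟩
      -- A skipped pair is not valid, so including it in the searched range imposes nothing.
      · refine ⟨⟨by simp [h3], h4, h5⟩, hB.congr ?_⟩
        rintro j' p' b ⟨h6, h7⟩ hv
        refine ⟨?_, h7⟩
        by_contra hcon
        obtain ⟨rfl, rfl⟩ : j' = j ∧ p' = p := by omega
        exact h hv
    · rintro s₂ ⟨⟨-, h4, h5⟩, hB⟩
      exact ⟨⟨by simp [h4], h5⟩, hB.congr fun j' p b h _ => by omega⟩

/-- The new row is written behind the current one, while the membership test reads only the current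
row, at `i` and at `p`; it is thus stable during the update. -/
theorem joins_congr {d : Data} {F : ℕ → ℕ} {X : ℕ → ℝ} {N : ℕ}
    (hF : ∀ m < d.base + N, F m = d.F m) (hX : ∀ m < d.base + N, X m = d.X m) {j p b i : ℕ}
    (hp : p < N) (hi : i < N) :
    ({ d with F := F, X := X } : Data).Joins j p b i ↔ d.Joins j p b i := by
  simp only [Data.Joins, Data.weight, hF (d.base + i) (by omega), hX (d.base + i) (by omega),
    hX (d.base + p) (by omega)]

theorem update_spec (hn : s.d.n = n) (hp : s.bp < n) :
    Triple n update s fun s' => ∃ F X,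
      s'.d = { s.d with
        F := F, X := X, E := Function.update s.d.E (s.d.K + 1) (s.d.E s.d.K + s.best),
        base := s.d.base + n, K := s.d.K + 1 } ∧
      (∀ m < s.d.base + n, F m = s.d.F m) ∧ (∀ m < s.d.base + n, X m = s.d.X m) ∧
      (∀ i < n, F (s.d.base + n + i) = 1 ↔
        s.d.F (s.d.base + i) = 1 ∨ s.d.Joins s.bj s.bp s.bb i) ∧
      (∀ i < n, i ≠ 0 → X (s.d.base + n + i) =
        if s.d.F (s.d.base + i) = 1 then s.d.X (s.d.base + i)
        else s.d.X (s.d.base + i) - s.best) ∧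
      X (s.d.base + n) = s.d.X s.d.base +
        ∑ i ∈ Finset.range n, if s.d.F (s.d.base + i) = 1 ∨ i = 0 then 0 else s.best := by
  refine .seq <| .set_j <| .seq <| .set_p <| .seq <| .set_b <| .seq <| .set_acc <| .seq <|
    (Triple.for_i (fun k s' => (s'.i = k ∧ s'.j = s.bj ∧ s'.p = s.bp ∧ s'.b = s.bb ∧
      s'.best = s.best) ∧ ∃ F X, s'.d = { s.d with F := F, X := X } ∧
      (∀ m < s.d.base + n, F m = s.d.F m) ∧ (∀ m < s.d.base + n, X m = s.d.X m) ∧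
      (∀ i < k, F (s.d.base + n + i) = 1 ↔
        s.d.F (s.d.base + i) = 1 ∨ s.d.Joins s.bj s.bp s.bb i) ∧
      (∀ i < k, i ≠ 0 → X (s.d.base + n + i) =
        if s.d.F (s.d.base + i) = 1 then s.d.X (s.d.base + i)
        else s.d.X (s.d.base + i) - s.best) ∧
      s'.acc = s.d.X s.d.base +
        ∑ i ∈ Finset.range k, if s.d.F (s.d.base + i) = 1 ∨ i = 0 then 0 else s.best)
      ?_ ?_ ?_).mono ?_
  · rintro k s' ⟨⟨h, -⟩, F, X, h', -⟩
    exact ⟨h, by rw [h', hn]⟩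
  · exact ⟨⟨rfl, rfl, rfl, rfl, rfl⟩, s.d.F, s.d.X, rfl, by simp, by simp, by simp, by simp,
      by simp [RExpr.eval, NExpr.eval, nVar, natArray, realArray]⟩
  · rintro k hk s₁ ⟨⟨hi, hj₁, hp₁, hb₁, hbest⟩, F, X, hd, hF, hX, hFk, hXk, hacc⟩
    have hF1 : F (s.d.base + k) = s.d.F (s.d.base + k) := hF _ (by omega)
    have hX1 : X (s.d.base + k) = s.d.X (s.d.base + k) := hX _ (by omega)
    have hJ := joins_congr (b := s.bb) (j := s.bj) hF hX hp hk
    have hstep : ∀ a, (a = 1 ↔ s.d.F (s.d.base + k) = 1 ∨ s.d.Joins s.bj s.bp s.bb k) →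
        (∀ m < s.d.base + n, Function.update F (s.d.base + n + k) a m = s.d.F m) ∧
        ∀ i < k + 1, Function.update F (s.d.base + n + k) a (s.d.base + n + i) = 1 ↔
          s.d.F (s.d.base + i) = 1 ∨ s.d.Joins s.bj s.bp s.bb i := fun a ha => by
      refine ⟨fun m hm => by rw [Function.update_of_ne (by omega), hF m hm], fun i hik => ?_⟩
      rcases Nat.lt_succ_iff_lt_or_eq.1 hik with h | rfl
      · rw [Function.update_of_ne (by omega), hFk i h]
      · rw [Function.update_self, ha]
    have hstepX : ∀ z, (k ≠ 0 → z = if s.d.F (s.d.base + k) = 1 then s.d.X (s.d.base + k)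
          else s.d.X (s.d.base + k) - s.best) →
        (∀ m < s.d.base + n, Function.update X (s.d.base + n + k) z m = s.d.X m) ∧
        ∀ i < k + 1, i ≠ 0 → Function.update X (s.d.base + n + k) z (s.d.base + n + i) =
          if s.d.F (s.d.base + i) = 1 then s.d.X (s.d.base + i)
          else s.d.X (s.d.base + i) - s.best := fun z hz => by
      refine ⟨fun m hm => by rw [Function.update_of_ne (by omega), hX m hm], fun i hik h0 => ?_⟩
      rcases Nat.lt_succ_iff_lt_or_eq.1 hik with h | rfl
      · rw [Function.update_of_ne (by omega), hXk i h h0]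
      · rw [Function.update_self, hz h0]
    -- The payoff half of the loop body, shared by both outcomes of the membership test.
    have hcond : ∀ {a : ℕ} {s₂ : Store},
        (a = 1 ↔ s.d.F (s.d.base + k) = 1 ∨ s.d.Joins s.bj s.bp s.bb k) →
        s₂ = { s₁ with d := { s₁.d with F := Function.update F (s.d.base + n + k) a } } →
        Triple n (.cond (.or (inF (nVar 8)) (.natEq (nVar 8) (.const 0)))
          (.setReal 4 (.add (.add (nVar 3) (nVar 0)) (nVar 8)) (.get 4 (.add (nVar 3) (nVar 8))))
          (.seq (.setReal 4 (.add (.add (nVar 3) (nVar 0)) (nVar 8))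
              (.sub (.get 4 (.add (nVar 3) (nVar 8))) (rVar 8)))
            (.setReal 9 (.const 0) (.add (rVar 9) (rVar 8))))) s₂ fun s' =>
          ({ s' with i := s'.i + 1 } : Store).i = k + 1 ∧ s'.j = s.bj ∧ s'.p = s.bp ∧
            s'.b = s.bb ∧ s'.best = s.best ∧ ∃ X', s'.d = { s.d with
              F := Function.update F (s.d.base + n + k) a, X := X' } ∧
            (∀ m < s.d.base + n, X' m = s.d.X m) ∧
            (∀ i < k + 1, i ≠ 0 → X' (s.d.base + n + i) =
              if s.d.F (s.d.base + i) = 1 then s.d.X (s.d.base + i)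
              else s.d.X (s.d.base + i) - s.best) ∧
            s'.acc = s.d.X s.d.base + ∑ i ∈ Finset.range (k + 1),
              if s.d.F (s.d.base + i) = 1 ∨ i = 0 then 0 else s.best := by
      rintro a s₂ ha rfl
      have hF2 := (hstep a ha).1 (s.d.base + k) (by omega)
      refine .cond (fun h => .set_X ?_) fun h => .seq <| .set_X <| .set_acc ?_
      all_goals
        simp only [BExpr.eval_or, eval_inF, BExpr.eval, NExpr.eval, nVar, nat_mem, natArray,
          cell_zero, hi, hd, hF2] at h
        simp only [RExpr.eval, NExpr.eval, nVar, rVar, nat_mem, real_mem, natArray, realArray,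
          cell_zero, hi, hd, hj₁, hp₁, hb₁, hbest, hX1, hn, hacc, true_and,
          Finset.sum_range_succ]
      · refine ⟨_, rfl, (hstepX _ fun h0 => ?_).1, (hstepX _ fun h0 => ?_).2, by simp [h]⟩ <;>
          rw [if_pos (h.resolve_right h0)]
      · have h1 := not_or.1 h
        refine ⟨_, rfl, (hstepX _ fun h0 => ?_).1, (hstepX _ fun h0 => ?_).2, ?_⟩
        · rw [if_neg h1.1]
        · rw [if_neg h1.1]
        · rw [if_neg h, add_assoc]
    refine .seq <| .cond (fun h => .set_F ?_) fun h => .set_F ?_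
    all_goals
      simp only [BExpr.eval_or, eval_inF, eval_joins, NExpr.eval, nVar, nat_mem, natArray,
        cell_zero, hi, hj₁, hp₁, hb₁, hd, hF1, hJ] at h
    · have ha : 1 = 1 ↔ s.d.F (s.d.base + k) = 1 ∨ s.d.Joins s.bj s.bp s.bb k := by simp [h]
      refine (hcond ha (by simp [NExpr.eval, nVar, natArray, hi, hd, hn])).mono ?_
      rintro s' ⟨h1, h2, h3, h4, h5, X', h6, h7, h8, h9⟩
      exact ⟨⟨h1, h2, h3, h4, h5⟩, _, X', h6, (hstep _ ha).1, h7, (hstep _ ha).2, h8, h9⟩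
    · have ha : 0 = 1 ↔ s.d.F (s.d.base + k) = 1 ∨ s.d.Joins s.bj s.bp s.bb k := by simp [h]
      refine (hcond ha (by simp [NExpr.eval, nVar, natArray, hi, hd, hn])).mono ?_
      rintro s' ⟨h1, h2, h3, h4, h5, X', h6, h7, h8, h9⟩
      exact ⟨⟨h1, h2, h3, h4, h5⟩, _, X', h6, (hstep _ ha).1, h7, (hstep _ ha).2, h8, h9⟩
  · rintro s₁ ⟨⟨hi, hj₁, hp₁, hb₁, hbest⟩, F, X, hd, hF, hX, hFk, hXk, hacc⟩
    refine .seq <| .set_X <| .seq <| .set_E <| .seq <| .set_base <| .set_K ?_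
    simp only [RExpr.eval, NExpr.eval, nVar, rVar, nat_mem, real_mem, natArray, realArray,
      cell_zero, hbest, hd, hn, hacc]
    refine ⟨F, _, rfl, hF, fun m hm => ?_, hFk, fun i hi h0 => ?_, ?_⟩
    · rw [Function.update_of_ne (by omega), hX m hm]
    · rw [Function.update_of_ne (by omega), hXk i hi h0]
    · rw [Function.update_self]

end Store

end RealRAM

/-! ### Reading the memory as a game and a log of states. -/

namespace RealRAM

open Coop SingleMarket

/-- Row `k` of the log. -/
def Data.log (n : ℕ) (d : Data) (k : ℕ) : PDState n where
  F := Finset.univ.filter fun i : Fin n => d.F (k * n + i) = 1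
  x := fun i => d.X (k * n + i)
  ε := d.E k

theorem Data.mem_log {n : ℕ} {d : Data} {k : ℕ} {i : Fin n} :
    i ∈ (d.log n k).F ↔ d.F (k * n + i) = 1 := by simp [Data.log]

/-- The data hold the game `G` and a log whose last row is row `K`. -/
structure Data.Holds {n : ℕ} (d : Data) (G : SingleMarket n) : Prop where
  n_eq : d.n = n
  r_eq : d.r = G.r
  c_eq : ∀ i : Fin n, d.c i = G.c i
  share_eq : ∀ i : Fin n, d.share i = G.share i
  base_eq : d.base = d.K * n

namespace Data.Holds

variable {n : ℕ} {G : SingleMarket n} {d : Data} (h : d.Holds G)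
include h

theorem weight_eq (j i : Fin n) : d.weight j i = G.weight (d.log n d.K) j i := by
  simp [Data.weight, SingleMarket.weight, Data.log, h.base_eq, h.r_eq, h.c_eq, h.share_eq]

variable [NeZero n]

theorem joins_iff (j p i : Fin n) (b : ℕ) :
    d.Joins j p b i ↔ i ∈ G.trial (d.log n d.K) j p b := by
  rw [mem_trial, Data.Joins, h.weight_eq, h.weight_eq, Data.mem_log, h.base_eq, Fin.val_inj,
    Fin.val_inj, Ne, Ne, Ne, Fin.val_eq_zero_iff]

theorem valid_iff (j p : Fin n) :
    d.Valid j p ↔ j ≠ 0 ∧ p ≠ 0 ∧ p ∉ (d.log n d.K).F := by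
  rw [Data.Valid, Data.mem_log, h.base_eq, Ne, Ne, Fin.val_eq_zero_iff, Fin.val_eq_zero_iff]

theorem trialRatio_eq (j p : Fin n) (b : ℕ) :
    d.trialRatio j p b = G.trialRatio (d.log n d.K) j p b := by
  have h1 : d.num j p b n =
      ∑ i ∈ G.trial (d.log n d.K) j p b, G.weight (d.log n d.K) j i - (d.log n d.K).ε := by
    simp only [Data.num, Finset.sum_range, h.joins_iff, h.weight_eq]
    rw [Finset.sum_ite_mem, Finset.univ_inter]
    simp only [Data.log]
    ring
  have h2 : d.den j p b n =
      1 + ((G.trial (d.log n d.K) j p b \ (d.log n d.K).F).card : ℝ) := by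
    simp only [Data.den, Finset.sum_range, h.joins_iff, h.base_eq, Ne, ← Data.mem_log,
      ← Finset.mem_sdiff]
    rw [Finset.sum_ite_mem, Finset.univ_inter]
    simp
  rw [Data.trialRatio, SingleMarket.trialRatio, h.n_eq, h1, h2]

end Data.Holds

end RealRAM

namespace SingleMarket

/-- Identifies what the update loop collects for player `0` with her component of the step. -/
theorem sum_dir {n : ℕ} [NeZero n] {F : Finset (Fin n)} (hF : 0 ∉ F) (z : ℝ) :
    (∑ i : Fin n, if i ∈ F ∨ i = 0 then 0 else z) = z * dir F 0 := by
  have h := pay_dir_univ hF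
  rw [Coop.pay, ← Finset.add_sum_erase _ _ (Finset.mem_univ 0)] at h
  rw [← Finset.add_sum_erase _ _ (Finset.mem_univ 0), if_pos (Or.inr rfl), zero_add,
    eq_neg_of_add_eq_zero_left h, mul_neg, Finset.mul_sum, ← Finset.sum_neg_distrib]
  refine Finset.sum_congr rfl fun i hi => ?_
  have h0 := (Finset.mem_erase.1 hi).1
  simp only [dir, h0, or_false, if_false]
  split_ifs <;> simp

theorem IsRun.succ {n : ℕ} [NeZero n] {G : SingleMarket n} {K : ℕ} {σ σ' : ℕ → PDState n}
    (h : G.IsRun K σ) (hσ : ∀ k ≤ K, σ' k = σ k) {S : Finset (Fin n)}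
    (hr : G.Round (σ K) S (σ' (K + 1))) : G.IsRun (K + 1) σ' := by
  refine ⟨by rw [hσ 0 (Nat.zero_le _), h.1], fun k hk => ?_⟩
  rcases Nat.lt_succ_iff_lt_or_eq.1 hk with hk | rfl
  · rw [hσ k hk.le, hσ (k + 1) hk]
    exact h.2 k hk
  · rw [hσ k le_rfl]
    exact ⟨S, hr⟩

end SingleMarket

/-! ### Correctness and running time of the program. -/

namespace RealRAM

open Coop SingleMarket NucleolusProgram

variable {n : ℕ} [NeZero n] {G : SingleMarket n}

/-- The rows of the log up to row `K` are the states of an execution of the algorithm, which has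
stopped unless `K = t`. -/
structure Data.IsLog (d : Data) (G : SingleMarket n) (t : ℕ) : Prop where
  holds : d.Holds G
  run : G.IsRun d.K (d.log n)
  stopped : Terminal (d.log n d.K) ∨ d.K = t

theorem Data.IsBest.terminal {d : Data} (h : d.Holds G) {V : ℕ → ℕ → ℕ → Prop} {bj bb : ℕ}
    {best : ℝ} (hB : d.IsBest V bj 0 bb best) (hV : ∀ j < n, ∀ p < n, V j p 0)
    (h0 : 0 ∉ (d.log n d.K).F) : Terminal (d.log n d.K) := by
  refine Finset.Subset.antisymm (by simpa using h0) fun p hp => ?_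
  by_contra hpF
  -- A player `p ≠ 0` outside `F` would make `(p, p)` a valid pair, so a trial would have been made.
  exact (hB.1 p p 0 (hV p p.2 p p.2)
    ((h.valid_iff p p).2 ⟨by simpa using hp, by simpa using hp, hpF⟩)).1 rfl

theorem Store.round_spec {s : Store} {t : ℕ} (h : s.d.IsLog G t) (ht : s.d.t = t) :
    Triple n NucleolusProgram.round s fun s' => s'.d.t = t ∧ s'.d.IsLog G (t + 1) := by
  have hi := h.run.inv _ le_rfl
  have hB0 := h.holds.base_eq
  refine .seq <| (search_spec h.holds.n_eq).mono ?_
  rintro s₁ ⟨hd, hB⟩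
  refine .cond (fun hb => .skip ?_) fun hb => ?_
  all_goals
    simp only [BExpr.eval, NExpr.eval, nVar, nat_mem, natArray, cell_zero] at hb
  · rw [hd]
    rw [hb] at hB
    exact ⟨ht, h.holds, h.run,
      Or.inl (hB.terminal h.holds (fun j hj p hp => ⟨hj, hp, two_pos⟩) hi.first)⟩
  · obtain ⟨hv, hj, hp, hbest⟩ := hB.2 hb
    rw [h.holds.n_eq] at hj hp
    refine (update_spec (by rw [hd, h.holds.n_eq]) hp).mono ?_
    rw [hd]
    rintro s' ⟨F, X, hd', hF, hX, hFn, hXn, hX0⟩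
    obtain ⟨j, hj'⟩ : ∃ j : Fin n, s₁.bj = j := ⟨⟨_, hj⟩, rfl⟩
    obtain ⟨p, hp'⟩ : ∃ p : Fin n, s₁.bp = p := ⟨⟨_, hp⟩, rfl⟩
    rw [hj', hp'] at hv hbest hFn
    obtain ⟨hj0, hp0, hpF⟩ := (h.holds.valid_iff j p).1 hv
    rw [h.holds.trialRatio_eq] at hbest
    -- Earlier rows lie below all cells written in this round.
    have hlog : ∀ k ≤ s.d.K, s'.d.log n k = s.d.log n k := by
      intro k hk
      have hlt : ∀ i : Fin n, k * n + i < s.d.base + n := fun i => by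
        have := Nat.mul_le_mul_right n hk
        omega
      rw [hd']
      ext i
      · simp only [Data.mem_log, hF _ (hlt i)]
      · simp only [Data.log, hX _ (hlt i)]
      · simp only [Data.log]
        rw [Function.update_of_ne (by omega)]
    have hrow : (s.d.K + 1) * n = s.d.base + n := by rw [hB0, Nat.succ_mul]
    have hround : G.Round (s.d.log n s.d.K)
        (G.trial (s.d.log n s.d.K) j p s₁.bb) (s'.d.log n (s.d.K + 1)) := by
      refine round_trial hi.first hj0 hp0 hpF (fun j' p' b' hb' h1 h2 h3 => ?_) ?_ ?_ ?_
      · rw [← hbest, ← h.holds.trialRatio_eq]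
        exact (hB.1 j' p' b' ⟨j'.2, p'.2, hb'⟩ ((h.holds.valid_iff j' p').2 ⟨h1, h2, h3⟩)).2
      · ext i
        rw [Data.mem_log, hd', Finset.mem_union, ← h.holds.joins_iff, Data.mem_log, ← hB0]
        simp only [hrow]
        rw [hFn i i.2, or_comm]
      · rw [← hbest]
        ext i
        change s'.d.X ((s.d.K + 1) * n + i) =
          s.d.X (s.d.K * n + i) + s₁.best * dir (s.d.log n s.d.K).F i
        rw [hd', hrow, ← hB0]
        dsimp only
        by_cases h0 : i = 0
        · subst h0
          have h4 := sum_dir hi.first s₁.best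
          simp only [Data.mem_log, ← hB0] at h4
          rw [Fin.val_zero, add_zero, hX0, Finset.sum_range, add_zero, ← h4]
          simp only [Fin.val_eq_zero_iff]
        · have h4 : i ∈ (s.d.log n s.d.K).F ↔ _ := Data.mem_log
          rw [← hB0] at h4
          rw [hXn i i.2 (by rwa [Ne, Fin.val_eq_zero_iff]), dir, if_neg h0]
          simp only [h4]
          split_ifs <;> ring
      · rw [← hbest]
        simp [Data.log, hd']
    refine ⟨by rw [hd', ht], ⟨?_, ?_, ?_, ?_, ?_⟩, ?_, ?_⟩
    · rw [hd', h.holds.n_eq]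
    · rw [hd', h.holds.r_eq]
    · simpa [hd'] using h.holds.c_eq
    · simpa [hd'] using h.holds.share_eq
    · rw [hd', hrow]
    · rw [show s'.d.K = s.d.K + 1 by rw [hd']]
      exact h.run.succ hlog hround
    -- A round was made, so the old state was not terminal and `K = t` held before it.
    · rw [show s'.d.K = s.d.K + 1 by rw [hd'], h.stopped.resolve_left hround.not_terminal]
      exact Or.inr rfl

omit [NeZero n] in
theorem Store.initial_spec {s : Store} (hn : s.d.n = n) :
    Triple n (forLoop 8 (.setReal 4 (nVar 8) (.mul (.get 2 (nVar 8))
      (.sub (rVar 0) (.get 1 (.const 0)))))) s fun s' => ∃ X, s'.d = { s.d with X := X } ∧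
        ∀ i < n, X i = s.d.share i * (s.d.r - s.d.c 0) := by
  refine (Triple.for_i (fun k s' => s'.i = k ∧ ∃ X, s'.d = { s.d with X := X } ∧
    ∀ i < k, X i = s.d.share i * (s.d.r - s.d.c 0)) ?_ ?_ ?_).mono fun s' h => h.2
  · rintro k s' ⟨h, X, h', -⟩
    exact ⟨h, by rw [h', hn]⟩
  · exact ⟨rfl, s.d.X, rfl, by simp⟩
  · rintro k hk s₁ ⟨hi, X, hd, hX⟩
    refine .set_X ⟨by simp [hi], _, by rw [hd], fun i hik => ?_⟩
    simp only [RExpr.eval, NExpr.eval, nVar, rVar, nat_mem, real_mem, natArray, realArray,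
      cell_zero, hi, hd]
    change Function.update X s₁.i _ i = _
    rw [hi]
    rcases Nat.lt_succ_iff_lt_or_eq.1 hik with h | rfl
    · rw [Function.update_of_ne h.ne, hX i h]
    · rw [Function.update_self]

omit [NeZero n] in
theorem Store.output_spec {s : Store} (hn : s.d.n = n) :
    Triple n (forLoop 8 (.setReal 3 (nVar 8) (.get 4 (.add (nVar 3) (nVar 8))))) s
      fun s' => ∃ out, s'.d = { s.d with out := out } ∧
        ∀ i < n, out i = s.d.X (s.d.base + i) := by
  refine (Triple.for_i (fun k s' => s'.i = k ∧ ∃ out, s'.d = { s.d with out := out } ∧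
    ∀ i < k, out i = s.d.X (s.d.base + i)) ?_ ?_ ?_).mono fun s' h => h.2
  · rintro k s' ⟨h, X, h', -⟩
    exact ⟨h, by rw [h', hn]⟩
  · exact ⟨rfl, s.d.out, rfl, by simp⟩
  · rintro k hk s₁ ⟨hi, X, hd, hX⟩
    refine .set_out ⟨by simp [hi], _, by rw [hd], fun i hik => ?_⟩
    simp only [RExpr.eval, NExpr.eval, nVar, nat_mem, real_mem, natArray, realArray,
      cell_zero, hi, hd]
    change Function.update X s₁.i _ i = _
    rw [hi]
    rcases Nat.lt_succ_iff_lt_or_eq.1 hik with h | rfl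
    · rw [Function.update_of_ne h.ne, hX i h]
    · rw [Function.update_self]

/-- The variables of the program in the beginning. -/
noncomputable def initialStore (G : SingleMarket n) : Store where
  d :=
    { n := n, K := 0, base := 0, t := 0, F := 0, out := 0, X := 0, E := 0, r := G.r,
      c := G.input.real 1, share := G.input.real 2 }
  j := 0
  p := 0
  b := 0
  i := 0
  bj := 0
  bp := 0
  bb := 0
  num := 0
  den := 0
  best := 0
  acc := 0

omit [NeZero n] in
theorem initialStore_mem (G : SingleMarket n) : (initialStore G).mem = G.input := by
  rw [Store.mem, ← show (⟨G.input.nat, G.input.real⟩ : Mem) = G.input from rfl, Mem.mk.injEq]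
  constructor
  · ext a i
    unfold Store.natArray
    split <;> simp_all [initialStore, SingleMarket.input, cell]
  · ext a i
    unfold Store.realArray
    split <;> simp_all [initialStore, SingleMarket.input, cell]

theorem main_spec (G : SingleMarket n) :
    Store.Triple n main (initialStore G) fun s => s.d.IsLog G n ∧
      ∀ i < n, s.d.out i = s.d.X (s.d.base + i) := by
  have hc : ∀ i : Fin n, G.input.real 1 i = G.c i := fun i => by simp [SingleMarket.input]
  have hs : ∀ i : Fin n, G.input.real 2 i = G.share i := fun i => by simp [SingleMarket.input]
  refine .seq <| (Store.initial_spec (n := n) rfl).mono ?_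
  rintro s₁ ⟨X, hd, hX⟩
  refine .seq <| (Store.Triple.for_t (fun k s => s.d.t = k ∧ s.d.IsLog G k)
    (fun k s h => ⟨h.1, h.2.holds.n_eq⟩) ⟨rfl, ?_⟩ ?_).mono ?_
  · rw [hd]
    refine ⟨⟨rfl, rfl, hc, hs, by simp [initialStore]⟩, ⟨?_, fun k hk => by cases hk⟩, Or.inr rfl⟩
    ext i
    · simp [Data.log, start, initialStore]
    · have h0 := hc 0
      rw [Fin.val_zero] at h0
      simp only [Data.log, zero_mul, zero_add, hX i i.2]
      simp [start, initialStore, hs, h0]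
    · simp [Data.log, start, initialStore]
  · rintro k hk s ⟨ht, h⟩
    refine (Store.round_spec h ht).mono ?_
    rintro s' ⟨h1, h2⟩
    exact ⟨by simp [h1], ⟨h2.holds.1, h2.holds.2, h2.holds.3, h2.holds.4, h2.holds.5⟩, h2.run,
      h2.stopped⟩
  · rintro s ⟨-, h⟩
    refine (Store.output_spec h.holds.n_eq).mono ?_
    rintro s' ⟨out, hd, ho⟩
    rw [hd]
    exact ⟨⟨⟨h.holds.1, h.holds.2, h.holds.3, h.holds.4, h.holds.5⟩, h.run, h.stopped⟩, ho⟩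

theorem exists_program : ∃ (P : Prog) (C : ℕ), ∀ (n : ℕ) [NeZero n] (G : SingleMarket n),
    ∃ (m : Mem) (t : ℕ), Exec P G.input m t ∧ t ≤ C * n ^ 4 ∧
      nucleolus G.v = {outPayoff n m} ∧
      G.IsRun (outRounds m) (outLog n m) ∧
      Terminal (outLog n m (outRounds m)) ∧
      outPayoff n m = (outLog n m (outRounds m)).x := by
  refine ⟨main, main.work 1, fun n _ G => ?_⟩
  obtain ⟨s, t, hexec, ht, h, hout⟩ := main_spec G
  rw [initialStore_mem] at hexec
  have hn := NeZero.one_le (n := n)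
  -- After `n` passes, not having stopped would mean `n` rounds, but at most `n - 1` are possible.
  have hterm : Terminal (s.d.log n s.d.K) := by
    refine h.stopped.resolve_right fun hK => ?_
    have := h.run.le
    omega
  have hpay : outPayoff n s.mem = (s.d.log n s.d.K).x := by
    ext i
    simp only [Data.log, ← h.holds.base_eq]
    exact hout i i.2
  -- The exponent `4` is the value of `main.depth`.
  exact ⟨s.mem, t, hexec, ht.trans (main.work_le hn), hpay ▸ h.run.nucleolus_eq hterm, h.run,
    hterm, hpay⟩

end RealRAM

open Coop SingleMarket RealRAM in
theorem mainTheorem2 :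
    (∀ (n : ℕ) [NeZero n] (G : SingleMarket n),
      -- the starting state satisfies the invariant
      G.Inv G.start ∧
      -- one round, from any non-terminal state that satisfies the invariant
      (∀ s : PDState n, G.Inv s → ¬ Terminal s →
        -- optimality test for the current Maschler program
        ((∃ S ∈ candidates s.F, pay s.x S = G.v S + s.ε) →
          RPValue G.v (fam s.F) s.x s.ε 0 ∧
          DOptimal G.v (fam s.F) (pay s.x) s.x s.ε) ∧
        ((¬ ∃ S ∈ candidates s.F, pay s.x S = G.v S + s.ε) →
          RPValue G.v (fam s.F) s.x s.ε 1 ∧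
          DRPOptimal G.v (fam s.F) s.x s.ε (dir s.F) 1) ∧
        -- a round can always be performed
        (∃ (S : Finset (Fin n)) (s' : PDState n), G.Round s S s') ∧
        ∀ (S : Finset (Fin n)) (s' : PDState n), G.Round s S s' →
          -- the step length is the maximum feasible one; it is positive iff the test failed
          IsGreatest {l : ℝ | 0 ≤ l ∧ DFeasible G.v (fam s.F) (pay s.x)
            (fun i => s.x i + l * dir s.F i) (s.ε + l)} (G.ratio s S) ∧
          (0 < G.ratio s S ↔ RPValue G.v (fam s.F) s.x s.ε 1) ∧
          -- one primal-dual step solves the current Maschler program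
          RPValue G.v (fam s.F) s'.x s'.ε 0 ∧
          DOptimal G.v (fam s.F) (pay s.x) s'.x s'.ε ∧
          -- with an optimal dual certificate that is positive on the newly fixed constraints
          (∃ y : Finset (Fin n) → ℝ, POptimal G.v (fam s.F) (pay s.x) y ∧
            PObjective G.v (fam s.F) (pay s.x) y = s'.ε ∧
            0 < y S ∧ ∀ i ∈ S \ s.F, 0 < y {i}ᶜ) ∧
          -- the set grows strictly and the invariant is kept
          s.F ⊂ s'.F ∧ G.Inv s') ∧
      -- executions: at most `n - 1` rounds, and the final payoff vector is the nucleolus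
      (∀ (K : ℕ) (σ : ℕ → PDState n), G.IsRun K σ →
        K ≤ n - 1 ∧ (∀ k ≤ K, G.Inv (σ k)) ∧
        (Terminal (σ K) →
          IsRevisedMaschler G.v K (fun k => fam (σ k).F) (fun k => pay (σ k).x)
            (fun k => (σ (k + 1)).x) (fun k => (σ (k + 1)).ε) ∧
          nucleolus G.v = {(σ K).x}))) ∧
    -- a single program performs the algorithm in `O(n ^ 4)` steps
    (∃ (P : Prog) (C : ℕ), ∀ (n : ℕ) [NeZero n] (G : SingleMarket n),
      ∃ (m : Mem) (t : ℕ), Exec P G.input m t ∧ t ≤ C * n ^ 4 ∧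
        nucleolus G.v = {outPayoff n m} ∧
        G.IsRun (outRounds m) (outLog n m) ∧
        Terminal (outLog n m (outRounds m)) ∧
        outPayoff n m = (outLog n m (outRounds m)).x) := by
  refine ⟨fun n _ G => ⟨G.inv_start, fun s hs ht => ⟨hs.optimal_of_tight_candidate,
    hs.drpOptimal_dir, hs.exists_round ht, fun S s' hr => ?_⟩, fun K σ hσ => ⟨hσ.le, hσ.inv,
    fun ht => ⟨hσ.isRevisedMaschler ht, hσ.nucleolus_eq ht⟩⟩⟩, exists_program⟩
  obtain ⟨h1, h2, h3, h4⟩ := hr.optimal hs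
  exact ⟨hr.isGreatest hs, hr.ratio_pos_iff hs, h1, h2, ⟨certificate s.F S, h3, h4,
    certificate_pos (Finset.mem_filter.1 hr.mem).2.1 (Or.inl rfl),
    fun i hi => (hr.certificate_compl_pos hs hi).2⟩, hr.ssubset hs, hr.inv hs⟩
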